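/- Let $\mathbb K$ be a field, $N,n\ge 0$ integers, $J\subset \mathbb K[T_0,\dots,T_N]$ a homogeneous ideal, and suppose that the graded ring $A=\mathbb K[T_0,\dots,T_N]/J$ (each $T_i$ having degree $1$) is Cohen–Macaulay of Krull dimension $n$. Put $\mathfrak m=(T_0,\dots,T_N)\subset A$. For $i=1,\dots,n$ let $f_i,g_i\in A$ be homogeneous of the same degree $d_i$, and in the polynomial ring $A[\mathbf X]=A[X_1,Y_1,\dots,X_n,Y_n]$ put $L_i=Y_if_i-X_ig_i$. Let $\mathcal B=A[\mathbf X]/(L_1,\dots,L_n)$, graded by the degree in $A$ (so each $X_i$ and $Y_i$ has degree $0$), and let $H^0_{\mathfrak m}(\mathcal B)$ be the set of elements of $\mathcal B$ annihilated by a power of $\mathfrak m$. Write $a_n(A)=\inf\{\mu\in\mathbb Z : H^n_{\mathfrak m}(A)_{\nu}=0 \text{ for all } \nu>\mu\}$ and $$\gamma=-\bigl(a_n(A)+1\bigr)=-\inf\{\mu\in\mathbb Z : H^n_{\mathfrak m}(A)_\nu=0\text{ for all }\nu\ge\mu\}.$$ If the Koszul complex $K_\bullet(L_1,\dots,L_n;A[\mathbf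 X])$ is acyclic (its homology vanishes in all positive degrees), then $$H^0_{\mathfrak m}(\mathcal B)_\nu=0\qquad\text{for all } \nu\ge \Bigl(\sum_{i=1}^n d_i\Bigr)-\gamma .$$ -/

import Mathlib

open MvPolynomial

attribute [local instance] MvPolynomial.gradedAlgebra

noncomputable section

/-! ### Cohen–Macaulay rings -/

/-- A commutative ring is Cohen–Macaulay if it is Noetherian and every localization at a maximal
ideal has a regular sequence whose length is the Krull dimension of that localization.
(`RingTheory.Sequence.IsRegular` includes that the sequence generates a proper ideal.) -/
def IsCohenMacaulayRing (R : Type*) [CommRing R] : Prop :=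
  IsNoetherianRing R ∧
    ∀ (p : Ideal R) [p.IsMaximal], ∃ rs : List (Localization.AtPrime p),
      RingTheory.Sequence.IsRegular (Localization.AtPrime p) rs ∧
        (rs.length : WithBot ℕ∞) = ringKrullDim (Localization.AtPrime p)

/-! ### Koszul complexes -/

section Koszul

variable {R : Type*} [CommRing R] {n : ℕ}

/-- The Koszul differential `e_t ↦ ∑_{j ∈ t} ± L_j e_{t \ {j}}`, where the sign is `(-1)` to the
number of elements of `t` below `j`. An element `∑ c_t e_t` of the exterior algebra of `R^n` is
given by its coordinates `c : Finset (Fin n) → R`, the exterior degree of `e_t` being `#t`. -/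
def koszulDifferential (L : Fin n → R) :
    (Finset (Fin n) → R) →ₗ[R] (Finset (Fin n) → R) where
  toFun c s := ∑ j ∈ sᶜ, (-1) ^ (s.filter (· < j)).card * L j * c (insert j s)
  map_add' c c' := by
    funext s
    simp [mul_add, Finset.sum_add_distrib]
  map_smul' r c := by
    funext s
    simp only [Pi.smul_apply, smul_eq_mul, RingHom.id_apply, Finset.mul_sum]
    exact Finset.sum_congr rfl fun j _ => by ring

/-- The term `⋀^p R^n` of the Koszul complex: coordinates vanish outside subsets of size `p`. -/
def koszulTerm (R : Type*) [CommRing R] (n p : ℕ) : Submodule R (Finset (Fin n) → R) where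
  carrier := {c | ∀ s, s.card ≠ p → c s = 0}
  add_mem' hc hc' s hs := by simp [hc s hs, hc' s hs]
  zero_mem' _ _ := rfl
  smul_mem' r c hc s hs := by simp [hc s hs]

/-- The Koszul complex of `L` is acyclic: its homology vanishes in all degrees `p ≥ 1`. -/
def KoszulAcyclic (L : Fin n → R) : Prop :=
  ∀ p : ℕ, 1 ≤ p → ∀ c ∈ koszulTerm R n p, koszulDifferential L c = 0 →
    ∃ b ∈ koszulTerm R n (p + 1), koszulDifferential L b = c

end Koszul

/-! ### The graded coordinate ring `A = K[T_0, …, T_N] / J` -/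

section CoordinateRing

variable {K : Type*} [Field K] {N : ℕ}

/-- The ring `A = K[T_0, …, T_N] / J`. -/
def CoordRing (J : Ideal (MvPolynomial (Fin (N + 1)) K)) : Type _ :=
  MvPolynomial (Fin (N + 1)) K ⧸ J

instance (J : Ideal (MvPolynomial (Fin (N + 1)) K)) : CommRing (CoordRing J) :=
  inferInstanceAs (CommRing (MvPolynomial (Fin (N + 1)) K ⧸ J))

instance (J : Ideal (MvPolynomial (Fin (N + 1)) K)) : Algebra K (CoordRing J) :=
  inferInstanceAs (Algebra K (MvPolynomial (Fin (N + 1)) K ⧸ J))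

/-- The quotient map `K[T_0, …, T_N] → A`. -/
def toCoord (J : Ideal (MvPolynomial (Fin (N + 1)) K)) :
    MvPolynomial (Fin (N + 1)) K →ₐ[K] CoordRing J :=
  Ideal.Quotient.mkₐ K J

/-- The class in `A` of the variable `T_i`. -/
def coordVar (J : Ideal (MvPolynomial (Fin (N + 1)) K)) (i : Fin (N + 1)) : CoordRing J :=
  toCoord J (X i)

/-- The ideal `𝔪 = A_+ = (T_0, …, T_N)` of `A`. -/
def irrelevantIdeal (J : Ideal (MvPolynomial (Fin (N + 1)) K)) : Ideal (CoordRing J) :=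
  Ideal.span (Set.range (coordVar J))

/-- The graded piece `A_μ`, for `μ : ℤ` (zero if `μ < 0`). -/
def coordDeg (J : Ideal (MvPolynomial (Fin (N + 1)) K)) (μ : ℤ) : Submodule K (CoordRing J) :=
  if 0 ≤ μ then
    (homogeneousSubmodule (Fin (N + 1)) K μ.toNat).map (toCoord J).toLinearMap
  else ⊥

theorem mul_coordVar_mem (J : Ideal (MvPolynomial (Fin (N + 1)) K)) {μ : ℤ} {a : CoordRing J}
    (ha : a ∈ coordDeg J μ) (i : Fin (N + 1)) : a * coordVar J i ∈ coordDeg J (μ + 1) := by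
  unfold coordDeg at ha
  split_ifs at ha with h
  · obtain ⟨p, hp, rfl⟩ := ha
    have h1 : (μ + 1).toNat = μ.toNat + 1 := by omega
    rw [coordDeg, if_pos (by omega), h1]
    exact ⟨p * X i, IsHomogeneous.mul hp (isHomogeneous_X K i), by
      simp [coordVar]⟩
  · rw [(Submodule.mem_bot K).1 ha, zero_mul]
    exact zero_mem _

theorem mul_prod_coordVar_mem (J : Ideal (MvPolynomial (Fin (N + 1)) K)) {μ : ℤ}
    {a : CoordRing J} (ha : a ∈ coordDeg J μ) (s : Finset (Fin (N + 1))) :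
    a * ∏ i ∈ s, coordVar J i ∈ coordDeg J (μ + s.card) := by
  induction s using Finset.induction_on with
  | empty => simpa using ha
  | insert j s hj ih =>
    have := mul_coordVar_mem J ih j
    rw [Finset.prod_insert hj, Finset.card_insert_of_notMem hj, mul_comm (coordVar J j),
      ← mul_assoc]
    convert this using 2
    push_cast
    ring

theorem mul_prod_coordVar_pow_mem (J : Ideal (MvPolynomial (Fin (N + 1)) K)) {μ : ℤ}
    {a : CoordRing J} (ha : a ∈ coordDeg J μ) (s : Finset (Fin (N + 1))) (k : ℕ) :
    a * (∏ i ∈ s, coordVar J i) ^ k ∈ coordDeg J (μ + k * s.card) := by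
  induction k with
  | zero => simpa using ha
  | succ k ih =>
    have := mul_prod_coordVar_mem J ih s
    rw [pow_succ, ← mul_assoc]
    convert this using 2
    push_cast
    ring

/-! ### Local cohomology of `A` at `𝔪`, through the graded Čech complex -/

/-- The localization of `A` at `T_s = ∏_{i ∈ s} T_i`. -/
abbrev CechLoc (J : Ideal (MvPolynomial (Fin (N + 1)) K)) (s : Finset (Fin (N + 1))) : Type _ :=
  Localization.Away (∏ i ∈ s, coordVar J i)

/-- The graded piece of degree `μ` of the localization of `A` at `T_s`: the fractions `a / T_s^k`
with `a ∈ A` homogeneous of degree `μ + k * #s`. -/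
def cechLocDeg (J : Ideal (MvPolynomial (Fin (N + 1)) K)) (s : Finset (Fin (N + 1))) (μ : ℤ) :
    Submodule K (CechLoc J s) where
  carrier := {z | ∃ k : ℕ, ∃ a ∈ coordDeg J (μ + k * s.card),
    z * algebraMap (CoordRing J) (CechLoc J s) (∏ i ∈ s, coordVar J i) ^ k =
      algebraMap (CoordRing J) (CechLoc J s) a}
  zero_mem' := ⟨0, 0, zero_mem _, by simp⟩
  add_mem' := by
    rintro z w ⟨k, a, ha, hz⟩ ⟨l, b, hb, hw⟩
    refine ⟨k + l, a * (∏ i ∈ s, coordVar J i) ^ l + b * (∏ i ∈ s, coordVar J i) ^ k,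
      add_mem ?_ ?_, ?_⟩
    · convert mul_prod_coordVar_pow_mem J ha s l using 2
      push_cast
      ring
    · convert mul_prod_coordVar_pow_mem J hb s k using 2
      push_cast
      ring
    · rw [map_add, map_mul, map_mul, map_pow, map_pow, ← hz, ← hw]
      ring
  smul_mem' := by
    rintro r z ⟨k, a, ha, hz⟩
    refine ⟨k, r • a, Submodule.smul_mem _ r ha, ?_⟩
    rw [smul_mul_assoc, hz, Algebra.algebraMap_eq_smul_one, Algebra.algebraMap_eq_smul_one,
      smul_assoc]

theorem isUnit_cechLoc (J : Ideal (MvPolynomial (Fin (N + 1)) K)) {s t : Finset (Fin (N + 1))}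
    (h : s ⊆ t) :
    IsUnit (algebraMap (CoordRing J) (CechLoc J t) (∏ i ∈ s, coordVar J i)) :=
  isUnit_of_dvd_unit (map_dvd _ (Finset.prod_dvd_prod_of_subset s t _ h))
    (IsLocalization.Away.algebraMap_isUnit (∏ i ∈ t, coordVar J i))

/-- The canonical map from the localization at `T_s` to the localization at `T_t`, for `s ⊆ t`. -/
def cechRestrict (J : Ideal (MvPolynomial (Fin (N + 1)) K)) {s t : Finset (Fin (N + 1))}
    (h : s ⊆ t) : CechLoc J s →+* CechLoc J t :=
  IsLocalization.Away.lift (∏ i ∈ s, coordVar J i) (isUnit_cechLoc J h)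

theorem cechRestrict_algebraMap (J : Ideal (MvPolynomial (Fin (N + 1)) K))
    {s t : Finset (Fin (N + 1))} (h : s ⊆ t) (a : CoordRing J) :
    cechRestrict J h (algebraMap _ _ a) = algebraMap _ _ a :=
  IsLocalization.Away.lift_eq _ _ _

theorem cechRestrict_smul (J : Ideal (MvPolynomial (Fin (N + 1)) K))
    {s t : Finset (Fin (N + 1))} (h : s ⊆ t) (r : K) (z : CechLoc J s) :
    cechRestrict J h (r • z) = r • cechRestrict J h z := by
  rw [Algebra.smul_def, Algebra.smul_def, map_mul,
    IsScalarTower.algebraMap_apply K (CoordRing J) (CechLoc J s),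
    IsScalarTower.algebraMap_apply K (CoordRing J) (CechLoc J t), cechRestrict_algebraMap]

/-- The Čech differential of `T_0, …, T_N` on the sum over all `s` of the localizations at `T_s`:
`(d c)_s = ∑_{j ∈ s} ± c_{s \ {j}}`, with sign `(-1)` to the number of elements of `s` below `j`. -/
def cechDifferential (J : Ideal (MvPolynomial (Fin (N + 1)) K)) :
    (∀ s : Finset (Fin (N + 1)), CechLoc J s) →ₗ[K] (∀ s : Finset (Fin (N + 1)), CechLoc J s) where
  toFun c s := ∑ j ∈ s, (-1) ^ (s.filter (· < j)).card *
    cechRestrict J (Finset.erase_subset j s) (c (s.erase j))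
  map_add' c c' := by
    funext s
    simp [mul_add, Finset.sum_add_distrib]
  map_smul' r c := by
    funext s
    simp only [Pi.smul_apply, cechRestrict_smul, RingHom.id_apply, Finset.smul_sum,
      mul_smul_comm]

/-- The internal degree `μ` part of the Čech cochains supported on sets `s` satisfying `P`. -/
def cechCochains (J : Ideal (MvPolynomial (Fin (N + 1)) K)) (P : Finset (Fin (N + 1)) → Prop)
    (μ : ℤ) : Submodule K (∀ s : Finset (Fin (N + 1)), CechLoc J s) where
  carrier := {c | ∀ s, c s ∈ cechLocDeg J s μ ∧ (¬ P s → c s = 0)}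
  zero_mem' _ := ⟨zero_mem _, fun _ => rfl⟩
  add_mem' hc hc' s := ⟨add_mem (hc s).1 (hc' s).1, fun h => by
    simp [(hc s).2 h, (hc' s).2 h]⟩
  smul_mem' r c hc s := ⟨Submodule.smul_mem _ r (hc s).1, fun h => by
    simp [(hc s).2 h]⟩

/-- The Čech cocycles of cohomological degree `p` and internal degree `μ`. -/
def cechCocycles (J : Ideal (MvPolynomial (Fin (N + 1)) K)) (p : ℕ) (μ : ℤ) :
    Submodule K (∀ s : Finset (Fin (N + 1)), CechLoc J s) :=
  cechCochains J (fun s => s.card = p) μ ⊓ LinearMap.ker (cechDifferential J)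

/-- The Čech coboundaries of cohomological degree `p` and internal degree `μ`: images of cochains
supported on the sets of size `p - 1` (there are none if `p = 0`). -/
def cechCoboundaries (J : Ideal (MvPolynomial (Fin (N + 1)) K)) (p : ℕ) (μ : ℤ) :
    Submodule K (∀ s : Finset (Fin (N + 1)), CechLoc J s) :=
  (cechCochains J (fun s => s.card + 1 = p) μ).map (cechDifferential J)

/-- The graded piece `H^p_𝔪(A)_μ` of the local cohomology of `A`, computed as the cohomology of
the internal degree `μ` strand of the Čech complex of `T_0, …, T_N`. -/
abbrev LocalCohomologyDeg (J : Ideal (MvPolynomial (Fin (N + 1)) K)) (p : ℕ) (μ : ℤ) : Type _ :=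
  cechCocycles J p μ ⧸ (cechCoboundaries J p μ).submoduleOf (cechCocycles J p μ)

/-- `a_p(A) = inf {μ ∈ ℤ : H^p_𝔪(A)_ν = 0 for all ν > μ}`, an infimum in the extended reals. -/
def aInvariant (J : Ideal (MvPolynomial (Fin (N + 1)) K)) (p : ℕ) : EReal :=
  sInf ((fun μ : ℤ => ((μ : ℝ) : EReal)) ''
    {μ : ℤ | ∀ ν : ℤ, μ < ν → Subsingleton (LocalCohomologyDeg J p ν)})

/-! ### The linear forms `L_i` and the algebra `ℬ` -/

/-- The ring `A[𝐗] = A[X_1, …, X_n, Y_1, …, Y_n]`: `X_i` is the variable `Sum.inl i` and `Y_i` is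
the variable `Sum.inr i`. -/
abbrev BigRing (J : Ideal (MvPolynomial (Fin (N + 1)) K)) (n : ℕ) : Type _ :=
  MvPolynomial (Fin n ⊕ Fin n) (CoordRing J)

/-- The form `L_i = Y_i f_i - X_i g_i` of `A[𝐗]`. -/
def linForm (J : Ideal (MvPolynomial (Fin (N + 1)) K)) {n : ℕ} (f g : Fin n → CoordRing J)
    (i : Fin n) : BigRing J n :=
  X (Sum.inr i) * C (f i) - X (Sum.inl i) * C (g i)

/-- The algebra `ℬ = A[𝐗] / (L_1, …, L_n)`. -/
abbrev IncidenceRing (J : Ideal (MvPolynomial (Fin (N + 1)) K)) {n : ℕ}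
    (f g : Fin n → CoordRing J) : Type _ :=
  BigRing J n ⧸ Ideal.span (Set.range (linForm J f g))

/-- The part `A_ν[𝐗]` of `A[𝐗]`, for the grading given by the degree in `A`. -/
def bigDeg (J : Ideal (MvPolynomial (Fin (N + 1)) K)) (n : ℕ) (ν : ℤ) :
    Submodule K (BigRing J n) where
  carrier := {p | ∀ m, p.coeff m ∈ coordDeg J ν}
  zero_mem' m := by simp
  add_mem' hp hq m := by
    rw [coeff_add]
    exact add_mem (hp m) (hq m)
  smul_mem' r p hp m := by
    rw [coeff_smul]
    exact Submodule.smul_mem _ r (hp m)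

/-- The part `ℬ_ν` of `ℬ`, for the grading given by the degree in `A`. -/
def incidenceDeg (J : Ideal (MvPolynomial (Fin (N + 1)) K)) {n : ℕ}
    (f g : Fin n → CoordRing J) (ν : ℤ) : Submodule K (IncidenceRing J f g) :=
  (bigDeg J n ν).map
    (Ideal.Quotient.mkₐ K (Ideal.span (Set.range (linForm J f g)))).toLinearMap

/-- `H^0_𝔪(ℬ)_ν`: the elements of `ℬ_ν` that are annihilated by a power of `𝔪`. -/
def incidenceTorsionDeg (J : Ideal (MvPolynomial (Fin (N + 1)) K)) {n : ℕ}
    (f g : Fin n → CoordRing J) (ν : ℤ) : Submodule K (IncidenceRing J f g) :=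
  (Ideal.primaryComponent (IncidenceRing J f g) (irrelevantIdeal J)).restrictScalars K ⊓
    incidenceDeg J f g ν

end CoordinateRing

/-- `γ = -inf {μ ∈ ℤ : H^n_𝔪(A)_ν = 0 for all ν ≥ μ} = -(a_n(A) + 1)`. -/
def gammaInvariant {K : Type*} [Field K] {N : ℕ} (J : Ideal (MvPolynomial (Fin (N + 1)) K))
    (n : ℕ) : EReal :=
  -(aInvariant J n + 1)

end

/-! Write δ for the Čech differential of the T_i and ∂ for the Koszul differential of the L_i. The
theorem is a diagonal chase in the double complex they form over A[𝐗]. Lift a torsion element to b ∈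
A_ν[𝐗]. Every T_i^k b lies in (L) for some k, so δb = ∂c_1 with c_1 in bidegree (1, 1). Acyclicity
then gives c_2, c_3, … with δc_q = ∂c_{q+1}, until the Koszul complex, of length n, runs out. On the
way back, the last c_q is a δ-cocycle. Once c_{q+1} is δy up to a ∂-boundary, c_q - ∂y is a
δ-cocycle, hence a δ-coboundary if the local cohomology of A vanishes there. In Čech degree 0 the
only coboundary is 0, so b is a ∂-boundary, that is b ∈ (L). The chase is
`exists_prod_pow_smul_eq_linKoszul_add_cokoszul`.

Since e_t has degree ∑_{i ∈ t} d_i, the chase needs H^{#t}_𝔪(A) to vanish only in degree ν - ∑_{i ∈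
t} d_i. If #t = n, then t is the full set, and the bound on ν says exactly that this degree exceeds
a_n(A). If #t < n, Cohen–Macaulayness gives vanishing in every degree
(`gradedVanish_of_isCohenMacaulayRing`). For this, 𝔪 must have height at least n, which holds
because no maximal ideal has larger height than 𝔪 (`height_le_height_irrelevantIdeal`). A regular
sequence in A_𝔪 kills the lower cohomology by induction on its length
(`cokoszulVanish_of_isWeaklyRegular`), and passing to homogeneous components brings the vanishing
back to A.

Throughout, the Čech complex is treated as the direct limit over k of the Koszul cochain complexes
of the T_i^k, with transition maps a_s ↦ T_s^l a_s, where T_s = ∏_{i ∈ s} T_i. A class vanishes when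
it becomes a coboundary after such a transition. This avoids fractions and allows coefficients in
any module. -/

noncomputable section

/-! ### Koszul cochains with coefficients in a module -/

section Cokoszul

variable {ι : Type*} [LinearOrder ι]

/-- The sign `(-1)` to the number of elements of `s` below `j`. -/
def orderSign (s : Finset ι) (j : ι) : ℤ := (-1) ^ (s.filter (· < j)).card

theorem orderSign_mul_self (s : Finset ι) (j : ι) : orderSign s j * orderSign s j = 1 := by
  rw [orderSign, ← mul_pow]
  simp

theorem orderSign_insert {s : Finset ι} {j : ι} (hj : j ∉ s) (i : ι) :
    orderSign (insert j s) i = (if j < i then -1 else 1) * orderSign s i := by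
  unfold orderSign
  rw [Finset.filter_insert]
  split_ifs with h
  · rw [Finset.card_insert_of_notMem (by simp [hj]), pow_succ]
    ring
  · simp

theorem orderSign_erase {s : Finset ι} {j : ι} (hj : j ∈ s) (i : ι) :
    orderSign (s.erase j) i = (if j < i then -1 else 1) * orderSign s i := by
  have h := orderSign_insert (Finset.notMem_erase j s) i
  rw [Finset.insert_erase hj] at h
  rw [h]
  split_ifs <;> ring

theorem orderSign_insert_self (s : Finset ι) (j : ι) :
    orderSign (insert j s) j = orderSign s j := by
  unfold orderSign
  rw [Finset.filter_insert, if_neg (lt_irrefl j)]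

theorem ite_lt_add_ite_lt {i j : ι} (h : i ≠ j) :
    (if i < j then -1 else 1 : ℤ) = -(if j < i then -1 else 1) := by
  rcases lt_or_gt_of_ne h with h | h
  · simp [h, h.not_gt]
  · simp [h, h.not_gt]

variable {R : Type*} [CommRing R] {M : Type*} [AddCommGroup M] [Module R M]
  {M' : Type*} [AddCommGroup M'] [Module R M']

/-- The Koszul cochain differential `(δ a)_s = ∑_{j ∈ s} ± T_j a_{s \ {j}}` with coefficients in a
module. -/
def cokoszul (T : ι → R) : (Finset ι → M) →ₗ[R] (Finset ι → M) where
  toFun a s := ∑ j ∈ s, orderSign s j • T j • a (s.erase j)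
  map_add' a a' := by
    funext s
    simp [smul_add, Finset.sum_add_distrib]
  map_smul' r a := by
    funext s
    simp only [Pi.smul_apply, RingHom.id_apply, Finset.smul_sum]
    refine Finset.sum_congr rfl fun j _ => ?_
    rw [smul_comm r (orderSign s j), smul_comm r (T j)]

theorem cokoszul_apply (T : ι → R) (a : Finset ι → M) (s : Finset ι) :
    cokoszul T a s = ∑ j ∈ s, orderSign s j • T j • a (s.erase j) := rfl

theorem map_cokoszul (T : ι → R) (φ : M →ₗ[R] M') (a : Finset ι → M) :
    cokoszul T (fun s => φ (a s)) = fun s => φ (cokoszul T a s) := by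
  funext s
  simp [cokoszul_apply]

/-- Removing j then i, or i then j, leaves the same set with opposite signs, so exchanging the two
indices cancels the terms in pairs. -/
theorem cokoszul_cokoszul (T : ι → R) (a : Finset ι → M) : cokoszul T (cokoszul T a) = 0 := by
  funext s
  simp only [cokoszul_apply, Finset.smul_sum, Pi.zero_apply]
  rw [Finset.sum_sigma']
  refine Finset.sum_involution (fun x _ => ⟨x.2, x.1⟩) ?_ ?_ ?_ ?_
  · rintro ⟨j, i⟩ hx
    simp only [Finset.mem_sigma, Finset.mem_erase] at hx
    obtain ⟨hj, hij, hi⟩ := hx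
    simp only
    rw [orderSign_erase hj, orderSign_erase hi, ite_lt_add_ite_lt hij,
      Finset.erase_right_comm (a := i), smul_comm (T j) (_ : ℤ), smul_comm (T i) (_ : ℤ),
      smul_smul (orderSign s j), smul_smul (orderSign s i), smul_comm (T i) (T j), ← add_smul]
    convert zero_smul ℤ _ using 2
    ring
  · rintro ⟨j, i⟩ hx - h
    simp only [Finset.mem_sigma, Finset.mem_erase] at hx
    simp only [Sigma.mk.injEq] at h
    exact hx.2.1 h.1
  · rintro ⟨j, i⟩ hx
    simp only [Finset.mem_sigma, Finset.mem_erase] at hx ⊢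
    exact ⟨hx.2.2, Ne.symm hx.2.1, hx.1⟩
  · rintro ⟨j, i⟩ hx
    rfl

/-- Multiplication by `T_i` is homotopic to zero on the Koszul cochain complex. -/
theorem exists_cokoszul_eq_smul (T : ι → R) (i : ι) {p : ℕ} {a : Finset ι → M}
    (hp : ∀ s, s.card ≠ p → a s = 0) (ha : cokoszul T a = 0) :
    ∃ b : Finset ι → M, (∀ s, s.card + 1 ≠ p → b s = 0) ∧ cokoszul T b = T i • a := by
  -- The homotopy is contraction with e_i: up to sign its value at s is the coordinate at s ∪ {i}.
  refine ⟨fun s => if i ∈ s then 0 else orderSign s i • a (insert i s), fun s hs => ?_, ?_⟩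
  · dsimp only
    split_ifs with h
    · rfl
    · rw [hp _ (by rwa [Finset.card_insert_of_notMem h]), smul_zero]
  · funext s
    rw [cokoszul_apply, Pi.smul_apply]
    by_cases h : i ∈ s
    · rw [Finset.sum_eq_single_of_mem i h]
      · rw [if_neg (Finset.notMem_erase i s), Finset.insert_erase h, orderSign_erase h,
          smul_comm (T i), smul_smul, if_neg (lt_irrefl i), one_mul, orderSign_mul_self, one_smul]
      · intro j hj hji
        rw [if_pos (Finset.mem_erase.2 ⟨hji.symm, h⟩), smul_zero, smul_zero]
    · have h0 := congrFun ha (insert i s)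
      rw [cokoszul_apply, Finset.sum_insert h, Finset.erase_insert h, Pi.zero_apply,
        add_eq_zero_iff_eq_neg] at h0
      rw [orderSign_insert_self] at h0
      have h1 : T i • a s = orderSign s i • orderSign s i • T i • a s := by
        rw [smul_smul, orderSign_mul_self, one_smul]
      rw [h1, h0, smul_neg, Finset.smul_sum, ← Finset.sum_neg_distrib]
      refine Finset.sum_congr rfl fun j hj => ?_
      have hij : i ≠ j := fun e => h (e ▸ hj)
      rw [if_neg (fun h' => h (Finset.mem_of_mem_erase h')), orderSign_erase hj,
        orderSign_insert h, ite_lt_add_ite_lt hij, Finset.erase_insert_of_ne hij,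
        smul_comm (T j) (_ : ℤ), smul_smul, smul_smul, ← neg_smul]
      congr 1
      ring

/-- The transition maps of the direct system are chain maps, because T_j^(k+l) T_{s \ {j}}^l = T_s^l
T_j^k. -/
theorem cokoszul_prod_smul (T : ι → R) (k l : ℕ) (a : Finset ι → M) :
    cokoszul (fun i => T i ^ (k + l)) (fun s => (∏ i ∈ s, T i) ^ l • a s) =
      fun s => (∏ i ∈ s, T i) ^ l • cokoszul (fun i => T i ^ k) a s := by
  funext s
  simp only [cokoszul_apply, Finset.smul_sum]
  refine Finset.sum_congr rfl fun j hj => ?_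
  rw [smul_comm _ (orderSign s j), smul_smul, smul_smul, ← Finset.mul_prod_erase s T hj]
  congr 2
  ring

theorem cokoszul_eq_zero_of_card {T : ι → R} {p : ℕ} {b : Finset ι → M}
    (hb : ∀ s, s.card + 1 ≠ p → b s = 0) {s : Finset ι} (hs : s.card ≠ p) :
    cokoszul T b s = 0 := by
  rw [cokoszul_apply]
  refine Finset.sum_eq_zero fun j hj => ?_
  rw [hb _ (by rwa [Finset.card_erase_add_one hj]), smul_zero, smul_zero]

end Cokoszul

/-! ### The Koszul differential squares to zero -/

section KoszulSquare

variable {R : Type*} [CommRing R] {n : ℕ}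

theorem koszulDifferential_apply (L : Fin n → R) (c : Finset (Fin n) → R) (s : Finset (Fin n)) :
    koszulDifferential L c s = ∑ j ∈ sᶜ, orderSign s j • (L j * c (insert j s)) := by
  simp [koszulDifferential, orderSign, zsmul_eq_mul, mul_assoc]

theorem koszulDifferential_koszulDifferential (L : Fin n → R) (c : Finset (Fin n) → R) :
    koszulDifferential L (koszulDifferential L c) = 0 := by
  funext s
  simp only [koszulDifferential_apply, Finset.mul_sum, Finset.smul_sum, Pi.zero_apply]
  rw [Finset.sum_sigma']
  refine Finset.sum_involution (fun x _ => ⟨x.2, x.1⟩) ?_ ?_ ?_ ?_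
  · rintro ⟨j, i⟩ hx
    simp only [Finset.mem_sigma, Finset.mem_compl, Finset.mem_insert, not_or] at hx
    obtain ⟨hj, hij, hi⟩ := hx
    simp only
    rw [orderSign_insert hj, orderSign_insert hi, ite_lt_add_ite_lt hij,
      Finset.insert_comm i j]
    simp only [zsmul_eq_mul]
    push_cast
    ring
  · rintro ⟨j, i⟩ hx - h
    simp only [Finset.mem_sigma, Finset.mem_compl, Finset.mem_insert, not_or] at hx
    simp only [Sigma.mk.injEq] at h
    exact hx.2.1 h.1
  · rintro ⟨j, i⟩ hx
    simp only [Finset.mem_sigma, Finset.mem_compl, Finset.mem_insert, not_or] at hx ⊢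
    exact ⟨hx.2.2, Ne.symm hx.2.1, hx.1⟩
  · rintro ⟨j, i⟩ hx
    rfl

end KoszulSquare

/-! ### A weakly regular sequence kills local cohomology below its length -/

section WeaklyRegular

variable {ι : Type*} [LinearOrder ι] {R : Type*} [CommRing R]
  {M : Type*} [AddCommGroup M] [Module R M]

/-- By the homotopy, each T_i^k turns cocycles into coboundaries, hence so does the ideal these
powers generate; its radical contains x. -/
theorem exists_cokoszul_eq_pow_smul (T : ι → R) (k : ℕ) {x : R}
    (hx : x ∈ (Ideal.span (Set.range T)).radical) {p : ℕ} {a : Finset ι → M}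
    (hp : ∀ s, s.card ≠ p → a s = 0) (ha : cokoszul (fun i => T i ^ k) a = 0) :
    ∃ (e : ℕ) (b : Finset ι → M), (∀ s, s.card + 1 ≠ p → b s = 0) ∧
      cokoszul (fun i => T i ^ k) b = x ^ e • a := by
  have h1 : x ∈ (Ideal.span (Set.range fun i => T i ^ k)).radical := by
    refine Ideal.radical_le_radical_iff.2 (Ideal.span_le.2 ?_) hx
    rintro _ ⟨i, rfl⟩
    exact ⟨k, Ideal.subset_span ⟨i, rfl⟩⟩
  obtain ⟨e, he⟩ := h1
  refine ⟨e, ?_⟩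
  generalize x ^ e = y at he ⊢
  induction he using Submodule.span_induction with
  | mem y hy =>
    obtain ⟨i, rfl⟩ := hy
    exact exists_cokoszul_eq_smul _ i hp ha
  | zero => exact ⟨0, fun _ _ => rfl, by simp⟩
  | add y z _ _ hy hz =>
    obtain ⟨b, hb, hb'⟩ := hy
    obtain ⟨c, hc, hc'⟩ := hz
    exact ⟨b + c, fun s hs => by simp [hb s hs, hc s hs], by rw [map_add, hb', hc', add_smul]⟩
  | smul r y _ hy =>
    obtain ⟨b, hb, hb'⟩ := hy
    exact ⟨r • b, fun s hs => by simp [hb s hs], by rw [map_smul, hb', smul_assoc]⟩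

variable (M) in
/-- Cocycles of degree `p` of the Koszul complexes of the powers of `T` with coefficients in `M`
become coboundaries in the limit, i.e. the `p`-th local cohomology of `M` at `T` vanishes. -/
def CokoszulVanish (T : ι → R) (p : ℕ) : Prop :=
  ∀ (k : ℕ) (a : Finset ι → M), (∀ s, s.card ≠ p → a s = 0) →
    cokoszul (fun i => T i ^ k) a = 0 →
    ∃ (l : ℕ) (b : Finset ι → M), (∀ s, s.card + 1 ≠ p → b s = 0) ∧
      cokoszul (fun i => T i ^ (k + l)) b = fun s => (∏ i ∈ s, T i) ^ l • a s

/-- The connecting map of 0 → M → M → M/xM → 0, by hand: if xa = δb, then b is a cocycle modulo x,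
so in the limit b = δc + xe, and applying δ and cancelling x gives a = δe. -/
theorem exists_cokoszul_eq_of_smul {T : ι → R} {x : R} (hx : IsSMulRegular M x) {p : ℕ}
    (hv : ∀ q, q + 1 = p → CokoszulVanish (QuotSMulTop x M) T q) {k : ℕ} {a : Finset ι → M}
    (hp : ∀ s, s.card ≠ p → a s = 0) {b : Finset ι → M} (hb : ∀ s, s.card + 1 ≠ p → b s = 0)
    (hab : cokoszul (fun i => T i ^ k) b = x • a) :
    ∃ (l : ℕ) (b : Finset ι → M), (∀ s, s.card + 1 ≠ p → b s = 0) ∧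
      cokoszul (fun i => T i ^ (k + l)) b = fun s => (∏ i ∈ s, T i) ^ l • a s := by
  rcases p with _ | p
  -- In degree 0 there is nothing to bound with, so xa = 0 and a = 0 by regularity.
  · have hb0 : b = 0 := funext fun s => hb s (by simp)
    refine ⟨0, 0, fun _ _ => rfl, ?_⟩
    funext s
    have h : x • a s = x • (0 : M) := by
      have := congrFun hab s
      rw [hb0, map_zero] at this
      simpa using this.symm
    simp [hx h]
  · let φ : M →ₗ[R] QuotSMulTop x M := Submodule.mkQ _
    have hφ : ∀ m, φ m = 0 ↔ ∃ m', x • m' = m := by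
      intro m
      rw [Submodule.mkQ_apply, Submodule.Quotient.mk_eq_zero, Submodule.mem_smul_pointwise_iff_exists]
      simp
    obtain ⟨l, c, hc, hc'⟩ := hv p rfl k (fun s => φ (b s))
      (fun s hs => by rw [hb s (by simpa using hs), map_zero]) (by
        rw [map_cokoszul, hab]
        funext s
        exact (hφ _).2 ⟨a s, rfl⟩)
    -- Zero is lifted to zero, so that the lift keeps the support condition.
    have hlift : ∀ s, ∃ m, φ m = c s ∧ (c s = 0 → m = 0) := fun s => by
      by_cases h : c s = 0
      · exact ⟨0, by rw [h, map_zero], fun _ => rfl⟩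
      · obtain ⟨m, hm⟩ := Submodule.mkQ_surjective _ (c s)
        exact ⟨m, hm, fun h' => absurd h' h⟩
    choose c₁ hc₁ hc₁' using hlift
    have he : ∀ s, ∃ m, x • m = (∏ i ∈ s, T i) ^ l • b s -
        cokoszul (fun i => T i ^ (k + l)) c₁ s := by
      intro s
      rw [← hφ, map_sub, map_smul, sub_eq_zero]
      have h1 := congrFun hc' s
      have h2 := congrFun (map_cokoszul (fun i => T i ^ (k + l)) φ c₁) s
      simp only [hc₁] at h2
      rw [← h2, ← h1]
    choose e he using he
    refine ⟨l, e, fun s hs => ?_, ?_⟩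
    · refine hx (a₁ := e s) (a₂ := 0) ?_
      simp only
      rw [he, hb s hs, smul_zero, zero_sub, smul_zero, neg_eq_zero]
      exact cokoszul_eq_zero_of_card (fun t ht => hc₁' t (hc t ht)) (by simpa using hs)
    · have h3 : x • e = (fun s => (∏ i ∈ s, T i) ^ l • b s) -
          cokoszul (fun i => T i ^ (k + l)) c₁ := funext he
      have h4 : x • cokoszul (fun i => T i ^ (k + l)) e =
          x • fun s => (∏ i ∈ s, T i) ^ l • a s := by
        rw [← map_smul, h3, map_sub, cokoszul_cokoszul, sub_zero, cokoszul_prod_smul, hab]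
        funext s
        simp only [Pi.smul_apply]
        rw [smul_comm]
      funext s
      exact hx (congrFun h4 s)

/-- Factors of x are removed one at a time, each at the cost of a transition in the direct system.
-/
theorem exists_cokoszul_eq_of_pow_smul {T : ι → R} {x : R} (hx : IsSMulRegular M x) {p : ℕ}
    (hv : ∀ q, q + 1 = p → CokoszulVanish (QuotSMulTop x M) T q) (e : ℕ) {k : ℕ}
    {a : Finset ι → M} (hp : ∀ s, s.card ≠ p → a s = 0) {b : Finset ι → M}
    (hb : ∀ s, s.card + 1 ≠ p → b s = 0) (hab : cokoszul (fun i => T i ^ k) b = x ^ e • a) :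
    ∃ (l : ℕ) (b : Finset ι → M), (∀ s, s.card + 1 ≠ p → b s = 0) ∧
      cokoszul (fun i => T i ^ (k + l)) b = fun s => (∏ i ∈ s, T i) ^ l • a s := by
  induction e generalizing k a b with
  | zero => exact ⟨0, b, hb, by simpa using hab⟩
  | succ e ih =>
    obtain ⟨l, b₁, hb₁, h₁⟩ := exists_cokoszul_eq_of_smul hx hv (a := x ^ e • a)
      (fun s hs => by simp [hp s hs]) hb (by rw [hab, pow_succ', mul_smul])
    obtain ⟨l', b₂, hb₂, h₂⟩ := ih (k := k + l) (a := fun s => (∏ i ∈ s, T i) ^ l • a s)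
      (fun s hs => by simp [hp s hs]) hb₁ (by
        rw [h₁]
        funext s
        simp only [Pi.smul_apply]
        rw [smul_comm])
    refine ⟨l + l', b₂, hb₂, ?_⟩
    rw [← add_assoc, h₂]
    funext s
    rw [smul_smul, ← pow_add, add_comm l' l]

/-- Induction on the sequence: a power of its first element r makes a cocycle a coboundary, and the
vanishing for M/rM one degree lower removes that power. -/
theorem cokoszulVanish_of_isWeaklyRegular (T : ι → R) {rs : List R}
    (hrs : ∀ r ∈ rs, r ∈ (Ideal.span (Set.range T)).radical)
    (h : RingTheory.Sequence.IsWeaklyRegular M rs) {p : ℕ} (hp : p < rs.length) :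
    CokoszulVanish M T p := by
  induction rs generalizing M p with
  | nil => simp at hp
  | cons r rs ih =>
    rw [RingTheory.Sequence.isWeaklyRegular_cons_iff] at h
    intro k a hpa ha
    obtain ⟨e, b, hb, hab⟩ := exists_cokoszul_eq_pow_smul T k (hrs r (by simp)) hpa ha
    refine exists_cokoszul_eq_of_pow_smul h.1 (fun q hq => ?_) e hpa hb hab
    exact ih (fun r' hr' => hrs r' (by simp [hr'])) h.2
      (by simp only [List.length_cons] at hp; omega)

end WeaklyRegular

/-! ### The grading of A through the coaction of the multiplicative group -/

section Grading

variable {K : Type*} [Field K] {N : ℕ} {J : Ideal (MvPolynomial (Fin (N + 1)) K)}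

theorem aeval_C_mul_X_of_isHomogeneous {σ A : Type*} [CommRing A] [Algebra K A]
    {p : MvPolynomial σ K} {d : ℕ} (hp : p.IsHomogeneous d) (x : σ → A) :
    aeval (fun i => Polynomial.C (x i) * Polynomial.X) p =
      Polynomial.C (aeval x p) * Polynomial.X ^ d := by
  rw [aeval_def, aeval_def, eval₂_eq, eval₂_eq, map_sum, Finset.sum_mul]
  refine Finset.sum_congr rfl fun m hm => ?_
  have hd : ∑ i ∈ m.support, m i = d := by
    have := hp (mem_support_iff.1 hm)
    rw [← this, Finsupp.weight_apply, Finsupp.sum]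
    simp
  rw [map_mul, map_prod, ← hd, ← Finset.prod_pow_eq_pow_sum, mul_assoc, ← Finset.prod_mul_distrib]
  simp [mul_pow, Polynomial.algebraMap_apply]

theorem toCoord_surjective (J : Ideal (MvPolynomial (Fin (N + 1)) K)) :
    Function.Surjective (toCoord J) := Ideal.Quotient.mkₐ_surjective K J

theorem toCoord_eq_zero_iff {p : MvPolynomial (Fin (N + 1)) K} : toCoord J p = 0 ↔ p ∈ J :=
  Ideal.Quotient.eq_zero_iff_mem

theorem toCoord_eq_aeval (J : Ideal (MvPolynomial (Fin (N + 1)) K)) :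
    toCoord J = aeval (coordVar J) := by
  ext i
  simp [coordVar]

theorem aeval_C_mul_X_eq_sum (p : MvPolynomial (Fin (N + 1)) K) :
    aeval (fun i => Polynomial.C (coordVar J i) * Polynomial.X) p =
      ∑ d ∈ Finset.range (p.totalDegree + 1),
        Polynomial.C (toCoord J (homogeneousComponent d p)) * Polynomial.X ^ d := by
  conv_lhs => rw [← sum_homogeneousComponent p, map_sum]
  refine Finset.sum_congr rfl fun d _ => ?_
  rw [aeval_C_mul_X_of_isHomogeneous (homogeneousComponent_isHomogeneous d p), toCoord_eq_aeval]

theorem homogeneousComponent_mem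
    (hJ : J.IsHomogeneous (homogeneousSubmodule (Fin (N + 1)) K))
    {p : MvPolynomial (Fin (N + 1)) K} (hp : p ∈ J) (d : ℕ) : homogeneousComponent d p ∈ J := by
  have := hJ d hp
  rwa [← decomposition.decompose'_apply]

/-- The coaction `A → A[X]` of the multiplicative group, sending `a` of degree `d` to `a X ^ d`. -/
def coaction (hJ : J.IsHomogeneous (homogeneousSubmodule (Fin (N + 1)) K)) :
    CoordRing J →ₐ[K] Polynomial (CoordRing J) :=
  Ideal.Quotient.liftₐ J (aeval fun i => Polynomial.C (coordVar J i) * Polynomial.X) fun p hp => by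
    rw [aeval_C_mul_X_eq_sum]
    refine Finset.sum_eq_zero fun d _ => ?_
    rw [toCoord_eq_zero_iff.2 (homogeneousComponent_mem hJ hp d), map_zero, zero_mul]

variable (hJ : J.IsHomogeneous (homogeneousSubmodule (Fin (N + 1)) K))

theorem coaction_toCoord (p : MvPolynomial (Fin (N + 1)) K) :
    coaction hJ (toCoord J p) =
      aeval (fun i => Polynomial.C (coordVar J i) * Polynomial.X) p := rfl

theorem coaction_coordVar (i : Fin (N + 1)) :
    coaction hJ (coordVar J i) = Polynomial.C (coordVar J i) * Polynomial.X := by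
  rw [coordVar, coaction_toCoord, aeval_X, coordVar]

theorem coaction_of_mem {d : ℕ} {a : CoordRing J} (ha : a ∈ coordDeg J d) :
    coaction hJ a = Polynomial.C a * Polynomial.X ^ d := by
  rw [coordDeg, if_pos (by omega), Int.toNat_natCast] at ha
  obtain ⟨p, hp, rfl⟩ := ha
  change coaction hJ (toCoord J p) = Polynomial.C (toCoord J p) * _
  rw [coaction_toCoord, aeval_C_mul_X_of_isHomogeneous hp, toCoord_eq_aeval]

theorem eq_zero_of_mem_coordDeg_of_neg {μ : ℤ} (hμ : μ < 0) {a : CoordRing J}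
    (ha : a ∈ coordDeg J μ) : a = 0 := by
  rw [coordDeg, if_neg (by omega)] at ha
  exact ha

theorem coaction_coeff_mem (a : CoordRing J) (d : ℕ) : (coaction hJ a).coeff d ∈ coordDeg J d := by
  obtain ⟨p, rfl⟩ := toCoord_surjective J a
  rw [coaction_toCoord, aeval_C_mul_X_eq_sum, Polynomial.finsetSum_coeff]
  refine sum_mem fun e _ => ?_
  rw [Polynomial.coeff_C_mul_X_pow]
  split_ifs with h
  · rw [coordDeg, if_pos (by omega), Int.toNat_natCast, h]
    exact ⟨_, homogeneousComponent_isHomogeneous e p, rfl⟩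
  · exact zero_mem _

/-- The projection of `A` onto its graded piece of degree `μ`. -/
def gradedPart (μ : ℤ) : CoordRing J →ₗ[K] CoordRing J :=
  if 0 ≤ μ then
    ((Polynomial.lcoeff (CoordRing J) μ.toNat).restrictScalars K) ∘ₗ (coaction hJ).toLinearMap
  else 0

theorem gradedPart_natCast (d : ℕ) (a : CoordRing J) :
    gradedPart hJ d a = (coaction hJ a).coeff d := by
  rw [gradedPart, if_pos (by omega)]
  rfl

theorem gradedPart_of_neg {μ : ℤ} (hμ : μ < 0) (a : CoordRing J) : gradedPart hJ μ a = 0 := by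
  rw [gradedPart, if_neg (by omega)]
  rfl

theorem gradedPart_mem (μ : ℤ) (a : CoordRing J) : gradedPart hJ μ a ∈ coordDeg J μ := by
  rcases lt_or_ge μ 0 with h | h
  · rw [gradedPart_of_neg hJ h]
    exact zero_mem _
  · lift μ to ℕ using h
    rw [gradedPart_natCast]
    exact coaction_coeff_mem hJ a μ

theorem gradedPart_eq_self {μ : ℤ} {a : CoordRing J} (ha : a ∈ coordDeg J μ) :
    gradedPart hJ μ a = a := by
  rcases lt_or_ge μ 0 with h | h
  · rw [gradedPart_of_neg hJ h, eq_zero_of_mem_coordDeg_of_neg h ha]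
  · lift μ to ℕ using h
    rw [gradedPart_natCast, coaction_of_mem hJ ha]
    simp

/-- The coaction sends f to f X^d, so multiplication by f shifts coefficients by d; negative degrees
are the case of a missing coefficient. -/
theorem gradedPart_mul {d : ℕ} {f : CoordRing J} (hf : f ∈ coordDeg J d) (μ : ℤ)
    (a : CoordRing J) : gradedPart hJ (μ + d) (f * a) = f * gradedPart hJ μ a := by
  rcases lt_or_ge (μ + d) 0 with h | h
  · rw [gradedPart_of_neg hJ h, gradedPart_of_neg hJ (by omega), mul_zero]
  · obtain ⟨e, he⟩ := Int.eq_ofNat_of_zero_le h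
    rw [he, gradedPart_natCast, map_mul, coaction_of_mem hJ hf, mul_assoc,
      Polynomial.coeff_C_mul, Polynomial.coeff_X_pow_mul']
    congr 1
    split_ifs with h'
    · have : μ = ((e - d : ℕ) : ℤ) := by omega
      rw [this, gradedPart_natCast]
    · rw [gradedPart_of_neg hJ (by omega)]

theorem gradedPart_mul_of_mem {μ : ℤ} {a : CoordRing J} (ha : a ∈ coordDeg J μ)
    (u : CoordRing J) : gradedPart hJ μ (u * a) = gradedPart hJ 0 u * a := by
  rcases lt_or_ge μ 0 with h | h
  · rw [gradedPart_of_neg hJ h, eq_zero_of_mem_coordDeg_of_neg h ha, mul_zero]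
  · lift μ to ℕ using h
    have := gradedPart_mul hJ ha 0 u
    rw [zero_add] at this
    rw [mul_comm u, this, mul_comm]

theorem mul_mem_coordDeg {μ : ℤ} {d : ℕ} {f a : CoordRing J} (hf : f ∈ coordDeg J d)
    (ha : a ∈ coordDeg J μ) : f * a ∈ coordDeg J (μ + d) := by
  rcases lt_or_ge μ 0 with h | h
  · rw [eq_zero_of_mem_coordDeg_of_neg h ha, mul_zero]
    exact zero_mem _
  · lift μ to ℕ using h
    rw [coordDeg, if_pos (by omega), Int.toNat_natCast] at hf ha
    obtain ⟨p, hp, rfl⟩ := hf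
    obtain ⟨q, hq, rfl⟩ := ha
    rw [coordDeg, if_pos (by omega)]
    refine ⟨p * q, ?_, by simp⟩
    have := IsHomogeneous.mul hp hq
    rwa [add_comm d μ] at this

theorem pow_coordVar_mem (i : Fin (N + 1)) (k : ℕ) :
    coordVar J i ^ k ∈ coordDeg J k := by
  rw [coordDeg, if_pos (by omega), Int.toNat_natCast]
  refine ⟨X i ^ k, ?_, by simp [coordVar]⟩
  simpa using (isHomogeneous_X K i).pow k

theorem prod_pow_coordVar_mem (s : Finset (Fin (N + 1))) (k : ℕ) :
    (∏ i ∈ s, coordVar J i) ^ k ∈ coordDeg J ((k * s.card : ℕ) : ℤ) := by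
  rw [coordDeg, if_pos (by omega), Int.toNat_natCast]
  refine ⟨(∏ i ∈ s, X i) ^ k, ?_, by simp [coordVar]⟩
  have h := (IsHomogeneous.prod s (fun i => (X i : MvPolynomial (Fin (N + 1)) K)) (fun _ => 1)
    fun i _ => isHomogeneous_X K i).pow k
  simpa [mul_comm] using h

theorem gradedPart_zero_of_mem_irrelevantIdeal {a : CoordRing J} (ha : a ∈ irrelevantIdeal J) :
    gradedPart hJ 0 a = 0 := by
  rw [irrelevantIdeal, Ideal.span] at ha
  induction ha using Submodule.span_induction with
  | mem y hy =>
    obtain ⟨i, rfl⟩ := hy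
    simpa using (gradedPart_natCast hJ 0 (coordVar J i)).trans (by simp [coaction_coordVar])
  | zero => exact map_zero _
  | add y z _ _ hy hz => rw [map_add, hy, hz, add_zero]
  | smul r y _ hy =>
    have h := gradedPart_natCast hJ 0
    simp only [Nat.cast_zero, smul_eq_mul] at h ⊢
    rw [h, map_mul, Polynomial.mul_coeff_zero, ← h y, hy, mul_zero]

theorem exists_algebraMap_sub_mem_irrelevantIdeal (a : CoordRing J) :
    ∃ c : K, a - algebraMap K _ c ∈ irrelevantIdeal J := by
  obtain ⟨p, rfl⟩ := toCoord_surjective J a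
  induction p using MvPolynomial.induction_on with
  | C c => exact ⟨c, by rw [← algebraMap_eq, AlgHom.commutes, sub_self]; exact zero_mem _⟩
  | add p q hp hq =>
    obtain ⟨c, hc⟩ := hp
    obtain ⟨d, hd⟩ := hq
    refine ⟨c + d, ?_⟩
    rw [map_add, map_add, add_sub_add_comm]
    exact add_mem hc hd
  | mul_X p i _ =>
    refine ⟨0, ?_⟩
    rw [map_zero, sub_zero, map_mul]
    exact Ideal.mul_mem_left _ _ (Ideal.subset_span ⟨i, rfl⟩)

theorem one_mem_coordDeg : (1 : CoordRing J) ∈ coordDeg J 0 := by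
  rw [coordDeg, if_pos le_rfl]
  exact ⟨1, isHomogeneous_one _ _, by simp⟩

theorem algebraMap_mem_coordDeg (c : K) : algebraMap K (CoordRing J) c ∈ coordDeg J 0 := by
  rw [Algebra.algebraMap_eq_smul_one]
  exact Submodule.smul_mem _ _ one_mem_coordDeg

theorem gradedPart_zero_sub_mem_irrelevantIdeal (a : CoordRing J) :
    a - gradedPart hJ 0 a ∈ irrelevantIdeal J := by
  obtain ⟨c, hc⟩ := exists_algebraMap_sub_mem_irrelevantIdeal a
  have h := gradedPart_zero_of_mem_irrelevantIdeal hJ hc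
  rw [map_sub, gradedPart_eq_self hJ (algebraMap_mem_coordDeg c), sub_eq_zero] at h
  rwa [h]

/-- Modulo 𝔪 every element is a scalar, and the degree 0 part sees only this scalar. Dividing by it
replaces inverting an element outside 𝔪. -/
theorem isUnit_gradedPart_zero {a : CoordRing J} (ha : a ∉ irrelevantIdeal J) :
    ∃ c : K, c ≠ 0 ∧ gradedPart hJ 0 a = algebraMap K _ c := by
  obtain ⟨c, hc⟩ := exists_algebraMap_sub_mem_irrelevantIdeal a
  have h := gradedPart_zero_of_mem_irrelevantIdeal hJ hc
  rw [map_sub, gradedPart_eq_self hJ (algebraMap_mem_coordDeg c), sub_eq_zero] at h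
  refine ⟨c, ?_, h⟩
  rintro rfl
  rw [map_zero, sub_zero] at hc
  exact ha hc

include hJ in
theorem irrelevantIdeal_isMaximal [Nontrivial (CoordRing J)] : (irrelevantIdeal J).IsMaximal := by
  rw [Ideal.isMaximal_iff]
  refine ⟨fun h => ?_, fun I x hI hx hxI => ?_⟩
  · have := gradedPart_zero_of_mem_irrelevantIdeal hJ h
    rw [gradedPart_eq_self hJ one_mem_coordDeg] at this
    exact one_ne_zero this
  · obtain ⟨c, hc, h⟩ := isUnit_gradedPart_zero hJ hx
    have h1 := I.sub_mem hxI (hI (gradedPart_zero_sub_mem_irrelevantIdeal hJ x))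
    rw [sub_sub_cancel, h] at h1
    have h2 := I.mul_mem_left (algebraMap K _ c⁻¹) h1
    rwa [← map_mul, inv_mul_cancel₀ hc, map_one] at h2

end Grading

/-! ### The irrelevant ideal has the largest height -/

section Height

/-- After localizing the base at the contraction p, any maximal ideal containing the extension of P
lies over the maximal ideal of R_p, and the height formula for maximal ideals of R_p[X] applies. -/
theorem Polynomial.height_le_height_comap_C_add_one {R : Type*} [CommRing R] [IsNoetherianRing R]
    (P : Ideal (Polynomial R)) [P.IsPrime] : P.height ≤ (P.comap Polynomial.C).height + 1 := by
  set p : Ideal R := P.comap Polynomial.C with hp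
  have : p.IsPrime := Ideal.comap_isPrime _ _
  let Rp := Localization.AtPrime p
  let _ : Algebra (Polynomial R) (Polynomial Rp) := Polynomial.algebra R Rp
  have : IsLocalization (p.primeCompl.map (Polynomial.C : R →+* Polynomial R)) (Polynomial Rp) :=
    Polynomial.isLocalization p.primeCompl Rp
  have disj : Disjoint (p.primeCompl.map (Polynomial.C : R →+* Polynomial R) : Set (Polynomial R))
      P := by
    refine Set.disjoint_left.mpr ?_
    rintro _ ⟨b, hb, rfl⟩ ha
    exact hb ha
  have hP' := IsLocalization.isPrime_of_isPrime_disjoint _ (Polynomial Rp) P ‹_› disj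
  rw [← IsLocalization.height_map_of_disjoint _ P disj (S := Polynomial Rp)]
  obtain ⟨Q, hQ, hPQ⟩ := Ideal.exists_le_maximal _ hP'.ne_top
  have hmax : IsLocalRing.maximalIdeal Rp ≤ Q.comap Polynomial.C := by
    rw [← Localization.AtPrime.map_eq_maximalIdeal, Ideal.map_le_iff_le_comap]
    intro r hr
    refine hPQ ?_
    have : (Polynomial.C (algebraMap R Rp r) : Polynomial Rp) =
        algebraMap (Polynomial R) (Polynomial Rp) (Polynomial.C r) := by
      simp [Polynomial.algebraMap_def]
    rw [this]
    exact Ideal.mem_map_of_mem _ hr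
  have heq : IsLocalRing.maximalIdeal Rp = Q.comap Polynomial.C :=
    (IsLocalRing.maximalIdeal.isMaximal Rp).eq_of_le (Ideal.comap_isPrime _ _).ne_top hmax
  have : Q.LiesOver (IsLocalRing.maximalIdeal Rp) := ⟨heq⟩
  refine (Ideal.height_mono hPQ).trans ?_
  rw [Polynomial.height_eq_height_add_one (IsLocalRing.maximalIdeal Rp) Q]
  refine add_le_add_left (le_of_eq ?_) 1
  rw [← WithBot.coe_inj, IsLocalRing.maximalIdeal_height_eq_ringKrullDim]
  exact IsLocalization.AtPrime.ringKrullDim_eq_height p Rp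

open LaurentPolynomial in
theorem LaurentPolynomial.height_le_height_comap_C_add_one {R : Type*} [CommRing R]
    [IsNoetherianRing R] (P : Ideal R[T;T⁻¹]) [P.IsPrime] :
    P.height ≤ (P.comap (LaurentPolynomial.C : R →+* R[T;T⁻¹])).height + 1 := by
  rw [← IsLocalization.height_under (Submonoid.powers (Polynomial.X : Polynomial R)) P]
  have : (P.under (Polynomial R)).IsPrime := Ideal.comap_isPrime _ _
  refine (Polynomial.height_le_height_comap_C_add_one _).trans (le_of_eq ?_)
  congr 2
  ext r
  simp [Ideal.mem_comap, LaurentPolynomial.algebraMap_eq_toLaurent]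

variable {K : Type*} [Field K] {N : ℕ} {J : Ideal (MvPolynomial (Fin (N + 1)) K)}
  (hJ : J.IsHomogeneous (homogeneousSubmodule (Fin (N + 1)) K))

open LaurentPolynomial

/-- The endomorphism of `A[T;T⁻¹]` given by `a ↦ a u ^ d` for `a` of degree `d`, and `T ↦ T`. -/
def laurentTwist (u : (CoordRing J)[T;T⁻¹]) : (CoordRing J)[T;T⁻¹] →+* (CoordRing J)[T;T⁻¹] :=
  LaurentPolynomial.eval₂
    ((Polynomial.eval₂RingHom LaurentPolynomial.C u).comp (coaction hJ : CoordRing J →+* _))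
    (isUnit_T 1).unit

theorem laurentTwist_T (u : (CoordRing J)[T;T⁻¹]) (m : ℤ) :
    laurentTwist hJ u (T m) = T m := by
  rw [laurentTwist, LaurentPolynomial.eval₂_T]
  obtain ⟨k, rfl | rfl⟩ := m.eq_nat_or_neg
  · simp [T_pow]
  · rw [zpow_neg, zpow_natCast]
    refine (Units.inv_eq_of_mul_eq_one_left ?_)
    rw [Units.val_pow_eq_pow_val]
    rw [IsUnit.unit_spec, T_pow, ← T_add, mul_one, neg_add_cancel, T_zero]

theorem laurentTwist_C (u : (CoordRing J)[T;T⁻¹]) (a : CoordRing J) :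
    laurentTwist hJ u (LaurentPolynomial.C a) =
      (coaction hJ a).eval₂ LaurentPolynomial.C u := by
  rw [laurentTwist, LaurentPolynomial.eval₂_C]
  rfl

/-- T_i goes to T_i u and then to T_i v u = T_i; this requires u to be fixed by the second twist,
hence a power of T. -/
theorem laurentTwist_comp {u v : (CoordRing J)[T;T⁻¹]} (hu : ∃ m, u = T m) (huv : u * v = 1) :
    (laurentTwist hJ v).comp (laurentTwist hJ u) = RingHom.id _ := by
  obtain ⟨m, rfl⟩ := hu
  have hC : ∀ a : CoordRing J, laurentTwist hJ v (laurentTwist hJ (T m) (LaurentPolynomial.C a)) =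
      LaurentPolynomial.C a := by
    intro a
    obtain ⟨p, rfl⟩ := toCoord_surjective J a
    induction p using MvPolynomial.induction_on with
    | C c =>
      rw [← algebraMap_eq, AlgHom.commutes, laurentTwist_C, AlgHom.commutes,
        Polynomial.algebraMap_apply, Polynomial.eval₂_C, laurentTwist_C, AlgHom.commutes,
        Polynomial.algebraMap_apply, Polynomial.eval₂_C]
    | add p q hp hq => simp only [map_add, hp, hq]
    | mul_X p i hp =>
      have hi : laurentTwist hJ v (laurentTwist hJ (T m) (LaurentPolynomial.C (toCoord J (X i)))) =
          LaurentPolynomial.C (toCoord J (X i)) := by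
        change laurentTwist hJ v (laurentTwist hJ (T m) (LaurentPolynomial.C (coordVar J i))) = _
        rw [laurentTwist_C, coaction_coordVar, Polynomial.eval₂_mul, Polynomial.eval₂_C,
          Polynomial.eval₂_X, map_mul, laurentTwist_T, laurentTwist_C, coaction_coordVar,
          Polynomial.eval₂_mul, Polynomial.eval₂_C, Polynomial.eval₂_X, mul_assoc, mul_comm v,
          huv, mul_one]
        rfl
      simp only [map_mul, hp, hi]
  refine RingHom.ext fun q => ?_
  rw [RingHom.comp_apply, RingHom.id_apply]
  induction q using LaurentPolynomial.induction_on' with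
  | add p q hp hq => simp only [map_add, hp, hq]
  | C_mul_T n a => rw [map_mul, map_mul, hC, laurentTwist_T, laurentTwist_T]

/-- The automorphism of `A[T;T⁻¹]` given by `a ↦ a T ^ d` for `a` of degree `d`, and `T ↦ T`. -/
def laurentTwistEquiv : (CoordRing J)[T;T⁻¹] ≃+* (CoordRing J)[T;T⁻¹] :=
  RingEquiv.ofRingHom (laurentTwist hJ (T 1)) (laurentTwist hJ (T (-1)))
    (laurentTwist_comp hJ ⟨-1, rfl⟩ (by rw [← T_add, ← T_zero]; congr 1))
    (laurentTwist_comp hJ ⟨1, rfl⟩ (by rw [← T_add, ← T_zero]; congr 1))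

include hJ in
-- Twisting P A[T;T⁻¹] by the grading preserves height, and the contraction p of the twisted prime
-- consists of elements whose homogeneous components all lie in P. Thus p ⊆ 𝔪. Either p = 𝔪, which
-- forces P = 𝔪, or p is strictly smaller and ht P ≤ ht p + 1 ≤ ht 𝔪.
theorem height_le_height_irrelevantIdeal [IsNoetherianRing (CoordRing J)]
    [Nontrivial (CoordRing J)] (P : Ideal (CoordRing J)) [hP : P.IsMaximal] :
    P.height ≤ (irrelevantIdeal J).height := by
  have hm := irrelevantIdeal_isMaximal hJ
  let Q : Ideal (Polynomial (CoordRing J)) := P.map Polynomial.C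
  have hQ : Q.IsPrime := have := hP.isPrime; Ideal.isPrime_map_C_of_isPrime
  have hX : Disjoint (Submonoid.powers (Polynomial.X : Polynomial (CoordRing J)) :
      Set (Polynomial (CoordRing J))) Q := by
    refine Set.disjoint_left.mpr ?_
    rintro _ ⟨k, rfl⟩ hk
    have := (Ideal.mem_map_C_iff.1 hk) k
    simp only [Polynomial.coeff_X_pow, if_true] at this
    exact hP.ne_top ((Ideal.eq_top_iff_one P).2 this)
  let Q' : Ideal (CoordRing J)[T;T⁻¹] := Q.map (algebraMap _ _)
  have hQ' : Q'.IsPrime := IsLocalization.isPrime_of_isPrime_disjoint _ _ Q hQ hX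
  have hhQ' : Q'.height = P.height := by
    rw [IsLocalization.height_map_of_disjoint _ Q hX, Polynomial.height_map_C]
  let P' := Q'.comap (laurentTwistEquiv hJ)
  have hP' : P'.IsPrime := Ideal.comap_isPrime _ _
  have hhP' : P'.height = P.height := by
    rw [← hhQ']
    exact RingEquiv.height_comap _ _
  let p := P'.comap (LaurentPolynomial.C : CoordRing J →+* _)
  have hp : p.IsPrime := Ideal.comap_isPrime _ _
  have hpm : ∀ a ∈ p, ∀ d, (coaction hJ a).coeff d ∈ P := by
    intro a ha d
    have h1 : laurentTwist hJ (T 1) (LaurentPolynomial.C a) ∈ Q' := ha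
    rw [laurentTwist_C] at h1
    have h2 : (coaction hJ a).eval₂ LaurentPolynomial.C (T 1) =
        algebraMap (Polynomial (CoordRing J)) (CoordRing J)[T;T⁻¹] (coaction hJ a) := by
      rw [LaurentPolynomial.algebraMap_eq_toLaurent]
      have : Polynomial.eval₂RingHom LaurentPolynomial.C (T 1) =
          (Polynomial.toLaurent : Polynomial (CoordRing J) →+* _) := by
        ext <;> simp
      exact congrArg (fun φ : Polynomial (CoordRing J) →+* _ => φ (coaction hJ a)) this
    rw [h2] at h1
    have h3 : coaction hJ a ∈ Q := by
      have := IsLocalization.under_map_of_isPrime_disjoint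
        (Submonoid.powers (Polynomial.X : Polynomial (CoordRing J))) (CoordRing J)[T;T⁻¹] hQ hX
      rw [← this]
      exact h1
    exact Ideal.mem_map_C_iff.1 h3 d
  have hle : p ≤ irrelevantIdeal J := by
    intro a ha
    by_contra h
    -- An element outside 𝔪 has a nonzero scalar as degree 0 component, which cannot lie in P.
    obtain ⟨c, hc, h0⟩ := isUnit_gradedPart_zero hJ h
    have h1 := hpm a ha 0
    rw [← gradedPart_natCast, Nat.cast_zero, h0] at h1
    exact hP.ne_top (Ideal.eq_top_of_isUnit_mem _ h1 ((IsUnit.mk0 c hc).map _))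
  rcases hle.eq_or_lt with h | h
  · have : irrelevantIdeal J ≤ P := by
      rw [irrelevantIdeal, Ideal.span_le]
      rintro _ ⟨i, rfl⟩
      have h1 : coordVar J i ∈ p := h ▸ Ideal.subset_span ⟨i, rfl⟩
      simpa [coaction_coordVar] using hpm _ h1 1
    rw [hm.eq_of_le hP.ne_top this]
  · rw [← hhP']
    exact (LaurentPolynomial.height_le_height_comap_C_add_one P').trans
      (Ideal.height_add_one_le_of_lt_of_isPrime h)

theorem nontrivial_of_ringKrullDim_eq {R : Type*} [CommRing R] {n : ℕ}
    (hdim : ringKrullDim R = n) : Nontrivial R := by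
  by_contra h
  rw [not_nontrivial_iff_subsingleton] at h
  rw [ringKrullDim_eq_bot_of_subsingleton] at hdim
  exact absurd hdim (by simp)

include hJ in
theorem le_height_irrelevantIdeal [IsNoetherianRing (CoordRing J)] {n : ℕ}
    (hdim : ringKrullDim (CoordRing J) = n) : ((n : ℕ∞) : WithBot ℕ∞) ≤ (irrelevantIdeal J).height := by
  have hnt := nontrivial_of_ringKrullDim_eq hdim
  have h := (ringKrullDim_le_iff_isMaximal_height_le (R := CoordRing J)
    (irrelevantIdeal J).height).2 fun P hP => by
      exact_mod_cast height_le_height_irrelevantIdeal hJ P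
  rw [hdim] at h
  exact h

end Height

/-! ### Vanishing of the graded pieces of local cohomology -/

section GradedVanishing

theorem map_cokoszul_ringHom {ι : Type*} [LinearOrder ι] {R S : Type*} [CommRing R] [CommRing S]
    (φ : R →+* S) (T : ι → R) (a : Finset ι → R) :
    cokoszul (fun i => φ (T i)) (fun s => φ (a s)) = fun s => φ (cokoszul T a s) := by
  funext s
  simp [cokoszul_apply]

variable {K : Type*} [Field K] {N : ℕ} {J : Ideal (MvPolynomial (Fin (N + 1)) K)}

/-- Homogeneous cocycles of bidegree `(p, μ)` of the Koszul complexes of the powers of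
`T_0, …, T_N` become coboundaries in the limit, i.e. `H^p_𝔪(A)_μ = 0`. -/
def GradedVanish (J : Ideal (MvPolynomial (Fin (N + 1)) K)) (p : ℕ) (μ : ℤ) : Prop :=
  ∀ (k : ℕ) (a : Finset (Fin (N + 1)) → CoordRing J),
    (∀ s, a s ∈ coordDeg J (μ + k * s.card)) → (∀ s, s.card ≠ p → a s = 0) →
    cokoszul (fun i => coordVar J i ^ k) a = 0 →
    ∃ (l : ℕ) (b : Finset (Fin (N + 1)) → CoordRing J),
      (∀ s, b s ∈ coordDeg J (μ + (k + l : ℕ) * s.card)) ∧ (∀ s, s.card + 1 ≠ p → b s = 0) ∧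
      cokoszul (fun i => coordVar J i ^ (k + l)) b = fun s => (∏ i ∈ s, coordVar J i) ^ l • a s

theorem prod_pow_mul_mem_coordDeg {μ : ℤ} {k : ℕ} {s : Finset (Fin (N + 1))} {a : CoordRing J}
    (ha : a ∈ coordDeg J (μ + k * s.card)) (l : ℕ) :
    (∏ i ∈ s, coordVar J i) ^ l * a ∈ coordDeg J (μ + (k + l : ℕ) * s.card) := by
  convert mul_mem_coordDeg (prod_pow_coordVar_mem s l) ha using 2
  push_cast
  ring

theorem cokoszul_gradedPart (hJ : J.IsHomogeneous (homogeneousSubmodule (Fin (N + 1)) K))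
    (μ : ℤ) (k : ℕ) (b : Finset (Fin (N + 1)) → CoordRing J) (s : Finset (Fin (N + 1))) :
    cokoszul (fun i => coordVar J i ^ k) (fun t => gradedPart hJ (μ + k * t.card) (b t)) s =
      gradedPart hJ (μ + k * s.card) (cokoszul (fun i => coordVar J i ^ k) b s) := by
  rw [cokoszul_apply, cokoszul_apply, map_sum]
  refine Finset.sum_congr rfl fun j hj => ?_
  rw [map_zsmul, smul_eq_mul, smul_eq_mul, ← gradedPart_mul hJ (pow_coordVar_mem j k),
    ← Finset.card_erase_add_one hj]
  congr 3
  push_cast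
  ring

/-- It suffices to find an arbitrary cochain that bounds a cocycle up to an element outside of the
irrelevant ideal. -/
theorem exists_graded_cokoszul_eq
    (hJ : J.IsHomogeneous (homogeneousSubmodule (Fin (N + 1)) K)) {p : ℕ} {μ : ℤ} {k l : ℕ}
    {a : Finset (Fin (N + 1)) → CoordRing J} (ha : ∀ s, a s ∈ coordDeg J (μ + k * s.card))
    {u : CoordRing J} (hu : u ∉ irrelevantIdeal J) {b : Finset (Fin (N + 1)) → CoordRing J}
    (hb : ∀ s, s.card + 1 ≠ p → b s = 0)
    (hab : ∀ s, cokoszul (fun i => coordVar J i ^ (k + l)) b s =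
      u * ((∏ i ∈ s, coordVar J i) ^ l * a s)) :
    ∃ b : Finset (Fin (N + 1)) → CoordRing J,
      (∀ s, b s ∈ coordDeg J (μ + (k + l : ℕ) * s.card)) ∧ (∀ s, s.card + 1 ≠ p → b s = 0) ∧
      cokoszul (fun i => coordVar J i ^ (k + l)) b =
        fun s => (∏ i ∈ s, coordVar J i) ^ l • a s := by
  obtain ⟨c, hc, h0⟩ := isUnit_gradedPart_zero hJ hu
  refine ⟨algebraMap K (CoordRing J) c⁻¹ • fun s =>
    gradedPart hJ (μ + (k + l : ℕ) * s.card) (b s), fun s => ?_, fun s hs => ?_, ?_⟩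
  · rw [Pi.smul_apply, algebraMap_smul]
    exact Submodule.smul_mem _ _ (gradedPart_mem hJ _ _)
  · rw [Pi.smul_apply, hb s hs, map_zero, smul_zero]
  · rw [map_smul]
    funext s
    rw [Pi.smul_apply, cokoszul_gradedPart, hab,
      gradedPart_mul_of_mem hJ (prod_pow_mul_mem_coordDeg (ha s) l), h0, smul_eq_mul, ← mul_assoc,
      ← map_mul, inv_mul_cancel₀ hc, map_one, one_mul, smul_eq_mul]

/-- A primitive over A_𝔪 becomes, after clearing denominators, a cochain over A bounding a multiple
of the cocycle by some u ∉ 𝔪; homogeneous components then remove u. -/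
theorem gradedVanish_of_cokoszulVanish_localization
    (hJ : J.IsHomogeneous (homogeneousSubmodule (Fin (N + 1)) K))
    [hm : (irrelevantIdeal J).IsMaximal] {p : ℕ}
    (hv : CokoszulVanish (Localization.AtPrime (irrelevantIdeal J))
      (fun i => algebraMap (CoordRing J) (Localization.AtPrime (irrelevantIdeal J))
        (coordVar J i)) p) (μ : ℤ) : GradedVanish J p μ := by
  intro k a ha hap hda
  let φ := algebraMap (CoordRing J) (Localization.AtPrime (irrelevantIdeal J))
  obtain ⟨l, b, hb, hab⟩ := hv k (fun s => φ (a s)) (fun s hs => by rw [hap s hs, map_zero]) (by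
    have := map_cokoszul_ringHom φ (fun i => coordVar J i ^ k) a
    simp only [map_pow] at this
    rw [this, hda]
    funext s
    simp)
  obtain ⟨u, hu⟩ := IsLocalization.exist_integer_multiples_of_finite
    (irrelevantIdeal J).primeCompl b
  choose b₁ hb₁ using hu
  -- A numerator of 0 in A_𝔪 need not be 0 in A, so the support condition is imposed again.
  let b₂ : Finset (Fin (N + 1)) → CoordRing J := fun s => if s.card + 1 = p then b₁ s else 0
  have hb₂ : ∀ s, φ (b₂ s) = φ u * b s := by
    intro s
    simp only [b₂]
    split_ifs with h
    · rw [hb₁, Algebra.smul_def]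
    · rw [hb s h, mul_zero, map_zero]
  have heq : ∀ s, φ (cokoszul (fun i => coordVar J i ^ (k + l)) b₂ s) =
      φ (u * ((∏ i ∈ s, coordVar J i) ^ l * a s)) := by
    intro s
    have h1 := congrFun (map_cokoszul_ringHom φ (fun i => coordVar J i ^ (k + l)) b₂) s
    simp only [map_pow, hb₂] at h1
    have h2 : (fun s => φ u * b s) = φ u • b := rfl
    rw [← h1, h2, map_smul, hab]
    simp [φ, map_prod]
  have hex : ∀ s, ∃ v : (irrelevantIdeal J).primeCompl,
      v * cokoszul (fun i => coordVar J i ^ (k + l)) b₂ s =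
        v * (u * ((∏ i ∈ s, coordVar J i) ^ l * a s)) := fun s =>
    (IsLocalization.eq_iff_exists (irrelevantIdeal J).primeCompl _).1 (heq s)
  choose v hv using hex
  have hvu : ((∏ s, v s : (irrelevantIdeal J).primeCompl) : CoordRing J) * u ∈
      (irrelevantIdeal J).primeCompl := mul_mem (SetLike.coe_mem _) (SetLike.coe_mem _)
  refine ⟨l, exists_graded_cokoszul_eq hJ ha
    (u := ((∏ s, v s : (irrelevantIdeal J).primeCompl) : CoordRing J) * u) hvu
    (b := ((∏ s, v s : (irrelevantIdeal J).primeCompl) : CoordRing J) • b₂) (fun s hs => ?_)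
    fun s => ?_⟩
  · simp [b₂, hs]
  · rw [map_smul, Pi.smul_apply, smul_eq_mul,
      ← Finset.mul_prod_erase _ _ (Finset.mem_univ s), Submonoid.coe_mul, mul_comm (v s : CoordRing J),
      mul_assoc, hv s]
    ring

theorem gradedVanish_of_isCohenMacaulayRing
    (hJ : J.IsHomogeneous (homogeneousSubmodule (Fin (N + 1)) K))
    (hCM : IsCohenMacaulayRing (CoordRing J)) {n : ℕ} (hdim : ringKrullDim (CoordRing J) = n)
    {p : ℕ} (hp : p < n) (μ : ℤ) : GradedVanish J p μ := by
  obtain ⟨hN, hreg⟩ := hCM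
  have hnt := nontrivial_of_ringKrullDim_eq hdim
  have hm := irrelevantIdeal_isMaximal hJ
  obtain ⟨rs, hrs, hlen⟩ := hreg (irrelevantIdeal J)
  -- The regular sequence has length ht 𝔪, which is at least n.
  rw [IsLocalization.AtPrime.ringKrullDim_eq_height (irrelevantIdeal J)] at hlen
  have hn := le_height_irrelevantIdeal hJ hdim
  rw [← hlen] at hn
  have hn' : n ≤ rs.length := by exact_mod_cast hn
  refine gradedVanish_of_cokoszulVanish_localization hJ
    (cokoszulVanish_of_isWeaklyRegular _ (fun r hr => ?_) hrs.toIsWeaklyRegular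
      (hp.trans_le hn')) μ
  have h1 : Ideal.ofList rs ≤ IsLocalRing.maximalIdeal _ := by
    refine IsLocalRing.le_maximalIdeal fun h => ?_
    have := hrs.top_ne_smul
    rw [h, Submodule.top_smul] at this
    exact this rfl
  have h2 : IsLocalRing.maximalIdeal (Localization.AtPrime (irrelevantIdeal J)) =
      Ideal.span (Set.range fun i => algebraMap (CoordRing J)
        (Localization.AtPrime (irrelevantIdeal J)) (coordVar J i)) := by
    rw [← Localization.AtPrime.map_eq_maximalIdeal]
    have h3 := Ideal.map_span (algebraMap (CoordRing J)
      (Localization.AtPrime (irrelevantIdeal J))) (Set.range (coordVar J))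
    rwa [← Set.range_comp] at h3
  rw [← h2]
  exact Ideal.le_radical (h1 (Ideal.subset_span hr))

/-- Over the common denominators T_s^k, the numerators of a Čech cochain form a Koszul cochain for
the T_i^k, and the two differentials agree. -/
theorem cechDifferential_mul_prod_pow {k : ℕ} {z : ∀ s : Finset (Fin (N + 1)), CechLoc J s}
    {a : Finset (Fin (N + 1)) → CoordRing J}
    (hz : ∀ s, z s * algebraMap (CoordRing J) (CechLoc J s) (∏ i ∈ s, coordVar J i) ^ k =
      algebraMap (CoordRing J) (CechLoc J s) (a s)) (s : Finset (Fin (N + 1))) :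
    cechDifferential J z s *
        algebraMap (CoordRing J) (CechLoc J s) (∏ i ∈ s, coordVar J i) ^ k =
      algebraMap (CoordRing J) (CechLoc J s) (cokoszul (fun i => coordVar J i ^ k) a s) := by
  rw [cokoszul_apply, map_sum]
  change (∑ j ∈ s, (-1) ^ (s.filter (· < j)).card *
    cechRestrict J (Finset.erase_subset j s) (z (s.erase j))) * _ = _
  rw [Finset.sum_mul]
  refine Finset.sum_congr rfl fun j hj => ?_
  have h := congrArg (cechRestrict J (Finset.erase_subset j s)) (hz (s.erase j))
  rw [map_mul, map_pow, cechRestrict_algebraMap, cechRestrict_algebraMap] at h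
  have h1 : algebraMap (CoordRing J) (CechLoc J s) (∏ i ∈ s, coordVar J i) =
      algebraMap (CoordRing J) (CechLoc J s) (coordVar J j) *
        algebraMap (CoordRing J) (CechLoc J s) (∏ i ∈ s.erase j, coordVar J i) := by
    rw [← map_mul, Finset.mul_prod_erase s _ hj]
  rw [map_zsmul, smul_eq_mul, map_mul, ← h, h1, map_pow, zsmul_eq_mul, orderSign]
  push_cast
  ring

theorem gradedVanish_of_subsingleton {p : ℕ} {μ : ℤ}
    (h : Subsingleton (LocalCohomologyDeg J p μ)) : GradedVanish J p μ := by
  intro k a ha hap hda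
  have hunit : ∀ s : Finset (Fin (N + 1)),
      IsUnit (algebraMap (CoordRing J) (CechLoc J s) (∏ i ∈ s, coordVar J i)) := fun s =>
    isUnit_cechLoc J subset_rfl
  have hz : ∀ s, ∃ z : CechLoc J s,
      z * algebraMap (CoordRing J) (CechLoc J s) (∏ i ∈ s, coordVar J i) ^ k =
        algebraMap (CoordRing J) (CechLoc J s) (a s) := fun s => by
    obtain ⟨w, hw⟩ := ((hunit s).pow k).exists_left_inv
    exact ⟨algebraMap _ _ (a s) * w, by rw [mul_assoc, hw, mul_one]⟩
  choose z hz using hz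
  have hzc : z ∈ cechCocycles J p μ := by
    refine ⟨fun s => ⟨⟨k, a s, ha s, hz s⟩, fun hs => ?_⟩, ?_⟩
    · refine ((hunit s).pow k).mul_left_injective ?_
      simp only
      rw [hz, hap s hs, map_zero, zero_mul]
    · refine LinearMap.mem_ker.2 (funext fun s => ?_)
      refine ((hunit s).pow k).mul_left_injective ?_
      simp only
      rw [cechDifferential_mul_prod_pow hz, hda, Pi.zero_apply, Pi.zero_apply, map_zero, zero_mul]
  have hzb : z ∈ cechCoboundaries J p μ := by
    have := (Submodule.Quotient.subsingleton_iff.1 h).symm ▸ Submodule.mem_top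
      (R := K) (x := (⟨z, hzc⟩ : cechCocycles J p μ))
    exact this
  obtain ⟨y, hy, rfl⟩ := hzb
  -- Denominators can be enlarged, so one exponent m serves all s.
  have hk : ∀ s, ∃ e : ℕ, ∀ m, e ≤ m → ∃ b ∈ coordDeg J (μ + m * s.card),
      y s * algebraMap (CoordRing J) (CechLoc J s) (∏ i ∈ s, coordVar J i) ^ m =
        algebraMap (CoordRing J) (CechLoc J s) b := fun s => by
    obtain ⟨e, b, hb, hyb⟩ := (hy s).1
    refine ⟨e, fun m hm => ?_⟩
    obtain ⟨m, rfl⟩ := Nat.exists_eq_add_of_le hm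
    refine ⟨_, prod_pow_mul_mem_coordDeg hb m, ?_⟩
    rw [pow_add, ← mul_assoc, hyb, map_mul, map_pow, mul_comm]
  choose e he using hk
  set m := Finset.univ.sup e
  have hb : ∀ s, ∃ b ∈ coordDeg J (μ + m * s.card),
      y s * algebraMap (CoordRing J) (CechLoc J s) (∏ i ∈ s, coordVar J i) ^ m =
        algebraMap (CoordRing J) (CechLoc J s) b ∧ (s.card + 1 ≠ p → b = 0) := fun s => by
    by_cases hs : s.card + 1 = p
    · obtain ⟨b, hb, hyb⟩ := he s m (Finset.le_sup (Finset.mem_univ s))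
      exact ⟨b, hb, hyb, fun h => absurd hs h⟩
    · exact ⟨0, zero_mem _, by rw [(hy s).2 hs, zero_mul, map_zero], fun _ => rfl⟩
  choose b hb hyb hbp using hb
  -- Equality of fractions gives equality in A only after multiplying by a power of T_s; r is a
  -- common power.
  have heq : ∀ s, ∃ e : ℕ, ∀ r, e ≤ r →
      (∏ i ∈ s, coordVar J i) ^ (k + r) * cokoszul (fun i => coordVar J i ^ m) b s =
        (∏ i ∈ s, coordVar J i) ^ (m + r) * a s := fun s => by
    have h1 : algebraMap (CoordRing J) (CechLoc J s)
        ((∏ i ∈ s, coordVar J i) ^ k * cokoszul (fun i => coordVar J i ^ m) b s) =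
        algebraMap (CoordRing J) (CechLoc J s) ((∏ i ∈ s, coordVar J i) ^ m * a s) := by
      rw [map_mul, map_mul, ← hz s, ← cechDifferential_mul_prod_pow hyb, map_pow, map_pow]
      ring
    obtain ⟨⟨_, e, rfl⟩, hc⟩ := (IsLocalization.eq_iff_exists
      (Submonoid.powers (∏ i ∈ s, coordVar J i)) (CechLoc J s)).1 h1
    refine ⟨e, fun r hr => ?_⟩
    obtain ⟨r, rfl⟩ := Nat.exists_eq_add_of_le hr
    simp only at hc
    linear_combination (∏ i ∈ s, coordVar J i) ^ r * hc
  choose e' he' using heq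
  set r := Finset.univ.sup e'
  -- The primitive over T_s^m is moved by the transition T_s^(k+r), and m + (k + r) = k + (m + r).
  refine ⟨m + r, fun s => (∏ i ∈ s, coordVar J i) ^ (k + r) * b s, fun s => ?_, fun s hs => ?_, ?_⟩
  · have := prod_pow_mul_mem_coordDeg (hb s) (k + r)
    rwa [show m + (k + r) = k + (m + r) by ring] at this
  · simp only [hbp s hs, mul_zero]
  · have h1 := cokoszul_prod_smul (coordVar J) m (k + r) b
    rw [show m + (k + r) = k + (m + r) by ring] at h1
    refine h1.trans (funext fun s => ?_)
    exact he' s r (Finset.le_sup (Finset.mem_univ s))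

end GradedVanishing

/-! ### The double complex and the diagonal chase -/

section DoubleComplex

variable {K : Type*} [Field K] {N n : ℕ} {J : Ideal (MvPolynomial (Fin (N + 1)) K)}

/-- The projection of `A[𝐗]` onto `A_μ[𝐗]`. -/
def bigPart (hJ : J.IsHomogeneous (homogeneousSubmodule (Fin (N + 1)) K)) (μ : ℤ)
    (p : BigRing J n) : BigRing J n :=
  ∑ m ∈ p.support, monomial m (gradedPart hJ μ (p.coeff m))

section BigPart

variable (hJ : J.IsHomogeneous (homogeneousSubmodule (Fin (N + 1)) K)) (μ : ℤ)

theorem coeff_bigPart (p : BigRing J n) (m : Fin n ⊕ Fin n →₀ ℕ) :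
    (bigPart hJ μ p).coeff m = gradedPart hJ μ (p.coeff m) := by
  rw [bigPart, coeff_sum]
  simp only [coeff_monomial]
  rw [Finset.sum_ite_eq' p.support m]
  split_ifs with h
  · rfl
  · rw [notMem_support_iff.1 h, map_zero]

theorem bigPart_mem (p : BigRing J n) : bigPart hJ μ p ∈ bigDeg J n μ := fun m => by
  rw [coeff_bigPart]
  exact gradedPart_mem hJ _ _

theorem bigPart_eq_self {p : BigRing J n} (hp : p ∈ bigDeg J n μ) : bigPart hJ μ p = p := by
  ext m
  rw [coeff_bigPart, gradedPart_eq_self hJ (hp m)]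

theorem bigPart_zero : bigPart hJ μ (0 : BigRing J n) = 0 := by
  ext m
  simp [coeff_bigPart]

theorem bigPart_sum {ι : Type*} (s : Finset ι) (p : ι → BigRing J n) :
    bigPart hJ μ (∑ i ∈ s, p i) = ∑ i ∈ s, bigPart hJ μ (p i) := by
  ext m
  simp [coeff_bigPart, coeff_sum]

theorem bigPart_zsmul (z : ℤ) (p : BigRing J n) :
    bigPart hJ μ (z • p) = z • bigPart hJ μ p := by
  ext m
  rw [coeff_bigPart, coeff_smul, coeff_smul, coeff_bigPart, map_zsmul]

theorem bigPart_sub (p q : BigRing J n) :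
    bigPart hJ μ (p - q) = bigPart hJ μ p - bigPart hJ μ q := by
  ext m
  simp [coeff_bigPart]

theorem bigPart_X_mul (v : Fin n ⊕ Fin n) (p : BigRing J n) :
    bigPart hJ μ (X v * p) = X v * bigPart hJ μ p := by
  ext m
  rw [coeff_bigPart, coeff_X_mul', coeff_X_mul']
  split_ifs
  · rw [coeff_bigPart]
  · rw [map_zero]

theorem bigPart_C_mul {d : ℕ} {f : CoordRing J} (hf : f ∈ coordDeg J d) (p : BigRing J n) :
    bigPart hJ (μ + d) (C f * p) = C f * bigPart hJ μ p := by
  ext m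
  rw [coeff_bigPart, coeff_C_mul, coeff_C_mul, coeff_bigPart, gradedPart_mul hJ hf]

theorem bigPart_linForm_mul {f g : Fin n → CoordRing J} {j : Fin n} {d : ℕ}
    (hf : f j ∈ coordDeg J d) (hg : g j ∈ coordDeg J d) (p : BigRing J n) :
    bigPart hJ (μ + d) (linForm J f g j * p) = linForm J f g j * bigPart hJ μ p := by
  rw [linForm, sub_mul, sub_mul, mul_assoc, mul_assoc, mul_assoc, mul_assoc, bigPart_sub,
    bigPart_X_mul, bigPart_X_mul, bigPart_C_mul hJ μ hf, bigPart_C_mul hJ μ hg]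

end BigPart

theorem smul_mem_bigDeg {μ : ℤ} {d : ℕ} {a : CoordRing J} (ha : a ∈ coordDeg J d)
    {p : BigRing J n} (hp : p ∈ bigDeg J n μ) : a • p ∈ bigDeg J n (μ + d) := fun m => by
  rw [coeff_smul]
  exact mul_mem_coordDeg ha (hp m)

/-- Cochains of the double complex of the Koszul cochain complex of the powers `T_i ^ k` and the
Koszul complex of the linear forms: `c s t` is homogeneous of the degree that makes both
differentials of degree zero, and vanishes unless `P #s` and `#t = q`. -/
def IsBigraded (J : Ideal (MvPolynomial (Fin (N + 1)) K)) (d : Fin n → ℕ) (ν : ℤ) (k : ℕ)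
    (P : ℕ → Prop) (q : ℕ)
    (c : Finset (Fin (N + 1)) → Finset (Fin n) → BigRing J n) : Prop :=
  ∀ s t, c s t ∈ bigDeg J n (ν - ∑ i ∈ t, (d i : ℤ) + k * s.card) ∧
    (¬ (P s.card ∧ t.card = q) → c s t = 0)

section

variable {d : Fin n → ℕ} {ν : ℤ} {k q : ℕ} {P : ℕ → Prop}
  {c c' : Finset (Fin (N + 1)) → Finset (Fin n) → BigRing J n}

theorem IsBigraded.sub (hc : IsBigraded J d ν k P q c) (hc' : IsBigraded J d ν k P q c') :
    IsBigraded J d ν k P q (c - c') := fun s t =>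
  ⟨sub_mem (hc s t).1 (hc' s t).1, fun h => by
    rw [Pi.sub_apply, Pi.sub_apply, (hc s t).2 h, (hc' s t).2 h, sub_zero]⟩

theorem IsBigraded.prod_pow_smul (hc : IsBigraded J d ν k P q c) (l : ℕ) :
    IsBigraded J d ν (k + l) P q fun s => (∏ i ∈ s, coordVar J i) ^ l • c s := fun s t => by
  refine ⟨?_, fun h => ?_⟩
  · change (∏ i ∈ s, coordVar J i) ^ l • c s t ∈ _
    convert smul_mem_bigDeg (prod_pow_coordVar_mem s l) (hc s t).1 using 2
    push_cast
    ring
  · change (∏ i ∈ s, coordVar J i) ^ l • c s t = 0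
    rw [(hc s t).2 h, smul_zero]

theorem IsBigraded.cokoszul (hc : IsBigraded J d ν k P q c) {P' : ℕ → Prop}
    (hP : ∀ m, P m → P' (m + 1)) :
    IsBigraded J d ν k P' q (cokoszul (fun i => coordVar J i ^ k) c) := fun s t => by
  rw [cokoszul_apply, Finset.sum_apply]
  refine ⟨sum_mem fun j hj => ?_, fun h => Finset.sum_eq_zero fun j hj => ?_⟩
  · rw [Pi.smul_apply, Pi.smul_apply]
    refine zsmul_mem ?_ _
    convert smul_mem_bigDeg (pow_coordVar_mem j k) (hc (s.erase j) t).1 using 2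
    rw [← Finset.card_erase_add_one hj]
    push_cast
    ring
  · rw [Pi.smul_apply, Pi.smul_apply, (hc (s.erase j) t).2, smul_zero, smul_zero]
    rintro ⟨h1, h2⟩
    refine h ⟨?_, h2⟩
    rw [← Finset.card_erase_add_one hj]
    exact hP _ h1

end

variable (hJ : J.IsHomogeneous (homogeneousSubmodule (Fin (N + 1)) K))
  {d : Fin n → ℕ} {f g : Fin n → CoordRing J}
  (hf : ∀ i, f i ∈ coordDeg J (d i)) (hg : ∀ i, g i ∈ coordDeg J (d i))

/-- The Koszul differential of the linear forms, as an `A`-linear map. -/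
def linKoszul (J : Ideal (MvPolynomial (Fin (N + 1)) K)) (f g : Fin n → CoordRing J) :
    (Finset (Fin n) → BigRing J n) →ₗ[CoordRing J] (Finset (Fin n) → BigRing J n) :=
  (koszulDifferential (linForm J f g)).restrictScalars (CoordRing J)

theorem linKoszul_apply (b : Finset (Fin n) → BigRing J n) (t : Finset (Fin n)) :
    linKoszul J f g b t = ∑ j ∈ tᶜ, orderSign t j • (linForm J f g j * b (insert j t)) :=
  koszulDifferential_apply _ _ _

theorem linKoszul_linKoszul (b : Finset (Fin n) → BigRing J n) :
    linKoszul J f g (linKoszul J f g b) = 0 :=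
  koszulDifferential_koszulDifferential _ _

include hf hg in
-- L_j has degree d_j, so with e_t placed in degree ∑_{i ∈ t} d_i the differential ∂ preserves
-- degree.
theorem linKoszul_bigPart (μ : ℤ) (b : Finset (Fin n) → BigRing J n) (t : Finset (Fin n)) :
    linKoszul J f g (fun t => bigPart hJ (μ - ∑ i ∈ t, (d i : ℤ)) (b t)) t =
      bigPart hJ (μ - ∑ i ∈ t, (d i : ℤ)) (linKoszul J f g b t) := by
  rw [linKoszul_apply, linKoszul_apply, bigPart_sum]
  refine Finset.sum_congr rfl fun j hj => ?_
  rw [bigPart_zsmul, ← bigPart_linForm_mul hJ _ (hf j) (hg j),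
    Finset.sum_insert (Finset.mem_compl.1 hj)]
  congr 2
  ring

include hJ hf hg in
theorem IsBigraded.linKoszul {ν : ℤ} {k q : ℕ} {P P' : ℕ → Prop}
    {c : Finset (Fin (N + 1)) → Finset (Fin n) → BigRing J n}
    (hc : IsBigraded J d ν k P (q + 1) c) (hP : ∀ m, P m → P' m) :
    IsBigraded J d ν k P' q fun s => linKoszul J f g (c s) := fun s t => by
  refine ⟨?_, fun h => ?_⟩
  · have h := linKoszul_bigPart hJ hf hg (ν + k * s.card) (c s) t
    have h' : (fun t => bigPart hJ (ν + k * s.card - ∑ i ∈ t, (d i : ℤ)) (c s t)) = c s := by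
      funext t
      rw [← sub_add_eq_add_sub]
      exact bigPart_eq_self hJ _ (hc s t).1
    rw [h', ← sub_add_eq_add_sub] at h
    change _root_.linKoszul J f g (c s) t ∈ _
    rw [h]
    exact bigPart_mem hJ _ _
  · change _root_.linKoszul J f g (c s) t = 0
    rw [linKoszul_apply]
    refine Finset.sum_eq_zero fun j hj => ?_
    rw [(hc s _).2, mul_zero, smul_zero]
    rintro ⟨h1, h2⟩
    rw [Finset.card_insert_of_notMem (Finset.mem_compl.1 hj)] at h2
    exact h ⟨hP _ h1, by omega⟩

include hJ hf hg in
-- Acyclicity is an ungraded hypothesis; projecting a primitive to the right degree makes it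
-- homogeneous without changing its boundary.
theorem exists_isBigraded_linKoszul_eq {ν : ℤ} {k q : ℕ} {P : ℕ → Prop}
    {c : Finset (Fin (N + 1)) → Finset (Fin n) → BigRing J n} (hc : IsBigraded J d ν k P q c)
    (h : ∀ s, ∃ b ∈ koszulTerm (BigRing J n) n (q + 1), linKoszul J f g b = c s) :
    ∃ c', IsBigraded J d ν k P (q + 1) c' ∧ ∀ s, linKoszul J f g (c' s) = c s := by
  have h' : ∀ s, ∃ b ∈ koszulTerm (BigRing J n) n (q + 1), linKoszul J f g b = c s ∧
      (¬ P s.card → b = 0) := fun s => by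
    by_cases hs : P s.card
    · obtain ⟨b, hb, hbc⟩ := h s
      exact ⟨b, hb, hbc, fun h => absurd hs h⟩
    · refine ⟨0, zero_mem _, ?_, fun _ => rfl⟩
      funext t
      rw [map_zero, Pi.zero_apply, (hc s t).2 fun h => hs h.1]
  choose b hb hbc hbP using h'
  refine ⟨fun s t => bigPart hJ (ν + k * s.card - ∑ i ∈ t, (d i : ℤ)) (b s t),
    fun s t => ⟨?_, fun hst => ?_⟩, fun s => ?_⟩
  · rw [sub_add_eq_add_sub]
    exact bigPart_mem hJ _ _
  · have : b s t = 0 := by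
      by_cases hs : P s.card
      · exact hb s t fun ht => hst ⟨hs, ht⟩
      · rw [hbP s hs, Pi.zero_apply]
    simp only [this, bigPart_zero]
  · funext t
    rw [linKoszul_bigPart hJ hf hg, hbc, ← sub_add_eq_add_sub]
    exact bigPart_eq_self hJ _ (hc s t).1

theorem GradedVanish.exists_forall_le {p : ℕ} {μ : ℤ} (h : GradedVanish J p μ) {k : ℕ}
    {a : Finset (Fin (N + 1)) → CoordRing J} (ha : ∀ s, a s ∈ coordDeg J (μ + k * s.card))
    (hap : ∀ s, s.card ≠ p → a s = 0) (hda : cokoszul (fun i => coordVar J i ^ k) a = 0) :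
    ∃ l : ℕ, ∀ l', l ≤ l' → ∃ b : Finset (Fin (N + 1)) → CoordRing J,
      (∀ s, b s ∈ coordDeg J (μ + (k + l' : ℕ) * s.card)) ∧ (∀ s, s.card + 1 ≠ p → b s = 0) ∧
      cokoszul (fun i => coordVar J i ^ (k + l')) b =
        fun s => (∏ i ∈ s, coordVar J i) ^ l' • a s := by
  obtain ⟨l, b, hb, hbp, hab⟩ := h k a ha hap hda
  refine ⟨l, fun l' hl => ?_⟩
  obtain ⟨r, rfl⟩ := Nat.exists_eq_add_of_le hl
  refine ⟨fun s => (∏ i ∈ s, coordVar J i) ^ r • b s, fun s => ?_, fun s hs => ?_, ?_⟩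
  · rw [← add_assoc]
    exact prod_pow_mul_mem_coordDeg (hb s) r
  · simp only [hbp s hs, smul_zero]
  · rw [← add_assoc, cokoszul_prod_smul, hab]
    funext s
    rw [smul_smul, ← pow_add, add_comm r l]

/-- Columns of the double complex have vanishing cohomology in the limit. -/
theorem exists_isBigraded_cokoszul_eq {ν : ℤ} {q : ℕ}
    (hv : ∀ t : Finset (Fin n), t.card = q → GradedVanish J q (ν - ∑ i ∈ t, (d i : ℤ))) {k : ℕ}
    {c : Finset (Fin (N + 1)) → Finset (Fin n) → BigRing J n}
    (hc : IsBigraded J d ν k (· = q) q c) (hdc : cokoszul (fun i => coordVar J i ^ k) c = 0) :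
    ∃ (l : ℕ) (b : Finset (Fin (N + 1)) → Finset (Fin n) → BigRing J n),
      IsBigraded J d ν (k + l) (· + 1 = q) q b ∧
      cokoszul (fun i => coordVar J i ^ (k + l)) b =
        fun s => (∏ i ∈ s, coordVar J i) ^ l • c s := by
  classical
  let φ : Finset (Fin n) → (Fin n ⊕ Fin n →₀ ℕ) →
      (Finset (Fin n) → BigRing J n) →ₗ[CoordRing J] CoordRing J := fun t m =>
    lcoeff (CoordRing J) m ∘ₗ LinearMap.proj t
  have hφ : ∀ t m b, φ t m b = (b t).coeff m := fun _ _ _ => rfl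
  -- δ acts on each coefficient separately. Only the finitely many monomials in W occur, so one
  -- exponent L suffices and the coefficientwise primitives assemble to polynomials.
  let W : Finset (Fin n ⊕ Fin n →₀ ℕ) :=
    Finset.univ.biUnion fun s => Finset.univ.biUnion fun t => (c s t).support
  have hW : ∀ s t m, m ∉ W → (c s t).coeff m = 0 := by
    intro s t m hm
    by_contra h
    exact hm (Finset.mem_biUnion.2 ⟨s, Finset.mem_univ s,
      Finset.mem_biUnion.2 ⟨t, Finset.mem_univ t, mem_support_iff.2 h⟩⟩)
  have hl : ∀ t m, ∃ l : ℕ, ∀ l', l ≤ l' → ∃ b : Finset (Fin (N + 1)) → CoordRing J,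
      (∀ s, b s ∈ coordDeg J (ν - ∑ i ∈ t, (d i : ℤ) + (k + l' : ℕ) * s.card)) ∧
      (∀ s, ¬ (s.card + 1 = q ∧ t.card = q) → b s = 0) ∧ (m ∉ W → b = 0) ∧
      cokoszul (fun i => coordVar J i ^ (k + l')) b =
        fun s => (∏ i ∈ s, coordVar J i) ^ l' • (c s t).coeff m := by
    intro t m
    by_cases htm : t.card = q ∧ m ∈ W
    · have hda := map_cokoszul (fun i => coordVar J i ^ k) (φ t m) c
      simp only [hdc, hφ, Pi.zero_apply, coeff_zero] at hda
      obtain ⟨l, hl⟩ := (hv t htm.1).exists_forall_le (fun s => (hc s t).1 m)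
        (fun s hs => by rw [(hc s t).2 fun h => hs h.1, coeff_zero]) hda
      refine ⟨l, fun l' hl' => ?_⟩
      obtain ⟨b, hb, hbp, hab⟩ := hl l' hl'
      exact ⟨b, hb, fun s hs => hbp s fun h => hs ⟨h, htm.1⟩, fun h => absurd htm.2 h, hab⟩
    · refine ⟨0, fun l' _ => ⟨0, fun _ => zero_mem _, fun _ _ => rfl, fun _ => rfl, ?_⟩⟩
      rw [map_zero]
      funext s
      by_cases ht : t.card = q
      · rw [hW s t m fun h => htm ⟨ht, h⟩, smul_zero, Pi.zero_apply]
      · rw [(hc s t).2 fun h => ht h.2, coeff_zero, smul_zero, Pi.zero_apply]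
  choose l hl using hl
  set L := Finset.univ.sup fun t => W.sup fun m => l t m with hL
  have hb : ∀ t m, ∃ b : Finset (Fin (N + 1)) → CoordRing J,
      (∀ s, b s ∈ coordDeg J (ν - ∑ i ∈ t, (d i : ℤ) + (k + L : ℕ) * s.card)) ∧
      (∀ s, ¬ (s.card + 1 = q ∧ t.card = q) → b s = 0) ∧ (m ∉ W → b = 0) ∧
      cokoszul (fun i => coordVar J i ^ (k + L)) b =
        fun s => (∏ i ∈ s, coordVar J i) ^ L • (c s t).coeff m := by
    intro t m
    by_cases hm : m ∈ W
    · exact hl t m L ((Finset.le_sup (f := fun m => l t m) hm).trans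
        (Finset.le_sup (f := fun t => W.sup fun m => l t m) (Finset.mem_univ t)))
    · refine ⟨0, fun _ => zero_mem _, fun _ _ => rfl, fun _ => rfl, ?_⟩
      rw [map_zero]
      funext s
      rw [hW s t m hm, smul_zero, Pi.zero_apply]
  choose b hb hbp hbW hab using hb
  have hcoeff : ∀ s t m, (∑ m' ∈ W, monomial m' (b t m' s)).coeff m = b t m s := by
    intro s t m
    rw [coeff_sum]
    simp only [coeff_monomial]
    rw [Finset.sum_ite_eq' W m]
    split_ifs with h
    · rfl
    · rw [hbW t m h, Pi.zero_apply]
  refine ⟨L, fun s t => ∑ m ∈ W, monomial m (b t m s), fun s t => ⟨fun m => ?_, fun h => ?_⟩, ?_⟩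
  · rw [hcoeff]
    exact hb t m s
  · ext m
    rw [hcoeff, hbp t m s h, coeff_zero]
  · funext s t
    ext m
    have h1 := congrFun (map_cokoszul (fun i => coordVar J i ^ (k + L)) (φ t m)
      fun s t => ∑ m ∈ W, monomial m (b t m s)) s
    simp only [hφ, hcoeff] at h1
    rw [← h1, Pi.smul_apply, coeff_smul]
    exact congrFun (hab t m) s

include hJ hf hg in
/-- The chase in the double complex: a cochain on the diagonal whose image under the column
differential is a Koszul boundary is itself, in the limit, the sum of a boundary of each kind. -/
theorem exists_prod_pow_smul_eq_linKoszul_add_cokoszul {ν : ℤ}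
    (hacyclic : KoszulAcyclic (linForm J f g))
    (hv : ∀ t : Finset (Fin n), GradedVanish J t.card (ν - ∑ i ∈ t, (d i : ℤ)))
    {q k : ℕ} {c c' : Finset (Fin (N + 1)) → Finset (Fin n) → BigRing J n}
    (hc : IsBigraded J d ν k (· = q) q c) (hc' : IsBigraded J d ν k (· = q + 1) (q + 1) c')
    (hcc' : ∀ s, cokoszul (fun i => coordVar J i ^ k) c s = linKoszul J f g (c' s)) :
    ∃ (l : ℕ) (e b : Finset (Fin (N + 1)) → Finset (Fin n) → BigRing J n),
      IsBigraded J d ν (k + l) (· + 1 = q) q b ∧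
      ∀ s, (∏ i ∈ s, coordVar J i) ^ l • c s =
        linKoszul J f g (e s) + cokoszul (fun i => coordVar J i ^ (k + l)) b s := by
  -- Descending induction on q, starting at q ≥ n + 1, where no subset of `Fin n` has q elements.
  obtain ⟨m, hm⟩ : ∃ m, n + 1 ≤ q + m := ⟨n + 1, by omega⟩
  induction m generalizing q k c c' with
  | zero =>
    refine ⟨0, 0, 0, fun s t => ⟨zero_mem _, fun _ => rfl⟩, fun s => ?_⟩
    have : c s = 0 := by
      funext t
      refine (hc s t).2 fun h => ?_
      have := Finset.card_le_univ t
      rw [Fintype.card_fin] at this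
      omega
    simp [this]
  | succ m ih =>
    have hcomm : ∀ (k : ℕ) (x : Finset (Fin (N + 1)) → Finset (Fin n) → BigRing J n),
        cokoszul (fun i => coordVar J i ^ k) (fun s => linKoszul J f g (x s)) =
          fun s => linKoszul J f g (cokoszul (fun i => coordVar J i ^ k) x s) :=
      fun k x => map_cokoszul _ (linKoszul J f g) x
    have hdc' : IsBigraded J d ν k (· = q + 1 + 1) (q + 1)
        (cokoszul (fun i => coordVar J i ^ k) c') := hc'.cokoszul fun m hm => by omega
    -- ∂δc' = δ∂c' = δδc = 0, so δc' is a Koszul cycle and acyclicity continues the staircase.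
    obtain ⟨c'', hc'', hcc''⟩ := exists_isBigraded_linKoszul_eq hJ hf hg hdc' fun s => by
      refine hacyclic (q + 1) (by omega) _ (fun t ht => (hdc' s t).2 fun h => ht h.2) ?_
      have h1 := congrFun (hcomm k c') s
      rw [← funext hcc', cokoszul_cokoszul] at h1
      exact h1.symm
    obtain ⟨l, e, b, hb, heb⟩ := ih hc' hc'' (fun s => (hcc'' s).symm) (by omega)
    -- In the limit c' = ∂e + δb, so δc = ∂c' = ∂δb = δ∂b: the corrected cochain c - ∂b is a
    -- δ-cocycle.
    have hx := (hc.prod_pow_smul l).sub (hb.linKoszul hJ hf hg fun m hm => Nat.succ_injective hm)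
    obtain ⟨l', y, hy, hxy⟩ := exists_isBigraded_cokoszul_eq (fun t ht => ht ▸ hv t) hx (by
      rw [map_sub, cokoszul_prod_smul, hcomm, sub_eq_zero]
      funext s
      have h1 := congrArg (linKoszul J f g) (heb s)
      rw [map_smul, map_add, linKoszul_linKoszul, zero_add] at h1
      rw [hcc', h1])
    refine ⟨l + l', fun s => (∏ i ∈ s, coordVar J i) ^ l' • b s, y, ?_, fun s => ?_⟩
    · rwa [← add_assoc]
    · rw [← add_assoc, hxy, map_smul, ← smul_add, Pi.sub_apply, add_sub_cancel, smul_smul,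
        ← pow_add, add_comm l' l]

end DoubleComplex

/-! ### From torsion elements to the chase, and the bound on ν -/

section Torsion

theorem exists_mem_koszulTerm_one {R : Type*} [CommRing R] {n : ℕ} {L : Fin n → R} {x : R}
    (hx : x ∈ Ideal.span (Set.range L)) :
    ∃ b ∈ koszulTerm R n 1, koszulDifferential L b = Pi.single ∅ x := by
  classical
  obtain ⟨β, rfl⟩ := (Submodule.mem_span_range_iff_exists_fun R).1 hx
  refine ⟨∑ j, Pi.single {j} (β j), sum_mem fun j _ s hs => ?_, ?_⟩
  · rw [Pi.single_eq_of_ne]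
    rintro rfl
    exact hs (Finset.card_singleton j)
  · funext t
    rw [koszulDifferential_apply]
    by_cases ht : t = ∅
    · subst ht
      rw [Pi.single_eq_same, Finset.compl_empty]
      refine Finset.sum_congr rfl fun j _ => ?_
      rw [Finset.sum_apply, Finset.sum_eq_single j]
      · simp [orderSign, mul_comm]
      · intro i _ hij
        rw [Pi.single_eq_of_ne]
        simpa using hij.symm
      · simp
    · rw [Pi.single_eq_of_ne ht]
      refine Finset.sum_eq_zero fun j hj => ?_
      rw [Finset.sum_apply, Finset.sum_eq_zero, mul_zero, smul_zero]
      intro i _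
      rw [Pi.single_eq_of_ne]
      intro h
      have h1 := congrArg Finset.card h
      rw [Finset.card_insert_of_notMem (Finset.mem_compl.1 hj), Finset.card_singleton] at h1
      exact ht (Finset.card_eq_zero.1 (by omega))

theorem koszulDifferential_empty_mem_span {R : Type*} [CommRing R] {n : ℕ} (L : Fin n → R)
    (b : Finset (Fin n) → R) : koszulDifferential L b ∅ ∈ Ideal.span (Set.range L) := by
  rw [koszulDifferential_apply]
  exact sum_mem fun j _ => zsmul_mem (Ideal.mul_mem_right _ _ (Ideal.subset_span (Set.mem_range_self j))) _

variable {K : Type*} [Field K] {N n : ℕ} {J : Ideal (MvPolynomial (Fin (N + 1)) K)}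

theorem exists_pow_smul_mem_span {f g : Fin n → CoordRing J} {b : BigRing J n}
    (hb : Ideal.Quotient.mk (Ideal.span (Set.range (linForm J f g))) b ∈
      Ideal.primaryComponent (IncidenceRing J f g) (irrelevantIdeal J)) :
    ∃ k : ℕ, ∀ i, coordVar J i ^ k • b ∈ Ideal.span (Set.range (linForm J f g)) := by
  obtain ⟨k, hk⟩ := (Ideal.primaryComponent_mem _ _ _).1 hb
  refine ⟨k, fun i => ?_⟩
  have h := (Submodule.mem_torsionBySet_iff _ _).1 hk
    ⟨coordVar J i ^ k, Ideal.pow_mem_pow (Ideal.subset_span (Set.mem_range_self i)) k⟩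
  rw [← Ideal.Quotient.eq_zero_iff_mem]
  exact h

/-- The chase is run on b placed in bidegree (0, 0), where δ-coboundaries are zero and ∂-boundaries
are the elements of (L). -/
theorem mem_span_of_pow_smul_mem_span
    (hJ : J.IsHomogeneous (homogeneousSubmodule (Fin (N + 1)) K))
    {d : Fin n → ℕ} {f g : Fin n → CoordRing J}
    (hf : ∀ i, f i ∈ coordDeg J (d i)) (hg : ∀ i, g i ∈ coordDeg J (d i))
    (hacyclic : KoszulAcyclic (linForm J f g)) {ν : ℤ}
    (hv : ∀ t : Finset (Fin n), GradedVanish J t.card (ν - ∑ i ∈ t, (d i : ℤ)))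
    {b : BigRing J n} (hb : b ∈ bigDeg J n ν) {k : ℕ}
    (hk : ∀ i, coordVar J i ^ k • b ∈ Ideal.span (Set.range (linForm J f g))) :
    b ∈ Ideal.span (Set.range (linForm J f g)) := by
  classical
  let c : Finset (Fin (N + 1)) → Finset (Fin n) → BigRing J n := Pi.single ∅ (Pi.single ∅ b)
  have hc : IsBigraded J d ν k (· = 0) 0 c := by
    intro s t
    by_cases hs : s = ∅
    · by_cases ht : t = ∅
      · subst hs ht
        simpa [c] using hb
      · simp [c, hs, Pi.single_eq_of_ne ht]
    · simp [c, Pi.single_eq_of_ne hs]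
  have hdc : IsBigraded J d ν k (· = 0 + 1) 0 (cokoszul (fun i => coordVar J i ^ k) c) :=
    hc.cokoszul fun m hm => by omega
  obtain ⟨c', hc', hcc'⟩ := exists_isBigraded_linKoszul_eq hJ hf hg hdc fun s => by
    have hmem : cokoszul (fun i => coordVar J i ^ k) c s ∈
        (koszulTerm (BigRing J n) n 1).map (koszulDifferential (linForm J f g)) := by
      rw [cokoszul_apply]
      refine sum_mem fun j _ => zsmul_mem ?_ _
      by_cases hs : s.erase j = ∅
      · have h1 : coordVar J j ^ k • c (s.erase j) = Pi.single ∅ (coordVar J j ^ k • b) := by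
          simp only [c, hs, Pi.single_eq_same, Pi.single_smul]
        rw [h1]
        exact exists_mem_koszulTerm_one (hk j)
      · simp [c, Pi.single_eq_of_ne hs]
    exact hmem
  obtain ⟨l, e, y, hy, hey⟩ := exists_prod_pow_smul_eq_linKoszul_add_cokoszul hJ hf hg hacyclic hv
    hc hc' fun s => (hcc' s).symm
  have h1 := congrFun (hey ∅) ∅
  have h2 : (∏ i ∈ (∅ : Finset (Fin (N + 1))), coordVar J i) ^ l • c ∅ = Pi.single ∅ b := by
    simp [c]
  have h3 : cokoszul (fun i => coordVar J i ^ (k + l)) y ∅ = 0 := by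
    rw [cokoszul_apply, Finset.sum_empty]
  rw [h2, h3, add_zero, Pi.single_eq_same] at h1
  rw [h1]
  exact koszulDifferential_empty_mem_span _ _

theorem subsingleton_localCohomologyDeg_of_aInvariant_lt {p : ℕ} {μ : ℤ}
    (h : aInvariant J p < ((μ : ℝ) : EReal)) : Subsingleton (LocalCohomologyDeg J p μ) := by
  obtain ⟨_, ⟨m, hm, rfl⟩, hlt⟩ := sInf_lt_iff.1 h
  simp only [EReal.coe_lt_coe_iff, Int.cast_lt] at hlt
  exact hm μ hlt

theorem aInvariant_lt_of_sub_gammaInvariant_le {D : ℕ} {ν : ℤ}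
    (h : (D : EReal) - gammaInvariant J n ≤ ((ν : ℝ) : EReal)) :
    aInvariant J n < (((ν - D : ℤ) : ℝ) : EReal) := by
  rw [gammaInvariant] at h
  generalize aInvariant J n = a at h
  induction a with
  -- Here a_n(A) = -∞ and γ = ∞, so the bound on ν is no restriction; in the last case γ = -∞ and no
  -- integer ν satisfies it.
  | bot => exact EReal.bot_lt_coe _
  | coe x =>
    have h' : (D : ℝ) - -(x + 1) ≤ (ν : ℝ) := by exact_mod_cast h
    rw [EReal.coe_lt_coe_iff]
    push_cast
    linarith
  | top =>
    exfalso
    have h1 : ((D : EReal) - -(⊤ + 1)) = ⊤ := by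
      rw [show (⊤ + 1 : EReal) = ⊤ from rfl, EReal.neg_top]
      exact EReal.coe_sub_bot (D : ℝ)
    rw [h1] at h
    exact EReal.coe_ne_top _ (top_le_iff.1 h)

end Torsion

end

theorem mainTheorem6 {K : Type*} [Field K] {N n : ℕ}
    (J : Ideal (MvPolynomial (Fin (N + 1)) K))
    (hJ : J.IsHomogeneous (homogeneousSubmodule (Fin (N + 1)) K))
    (hCM : IsCohenMacaulayRing (CoordRing J))
    (hdim : ringKrullDim (CoordRing J) = n)
    (d : Fin n → ℕ) (f g : Fin n → CoordRing J)
    (hf : ∀ i, f i ∈ coordDeg J (d i)) (hg : ∀ i, g i ∈ coordDeg J (d i))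
    (hacyclic : KoszulAcyclic (linForm J f g))
    (ν : ℤ) (hν : ((∑ i, d i : ℕ) : EReal) - gammaInvariant J n ≤ ((ν : ℝ) : EReal)) :
    incidenceTorsionDeg J f g ν = ⊥ := by
  have htop := gradedVanish_of_subsingleton
    (subsingleton_localCohomologyDeg_of_aInvariant_lt (aInvariant_lt_of_sub_gammaInvariant_le hν))
  have hv : ∀ t : Finset (Fin n), GradedVanish J t.card (ν - ∑ i ∈ t, (d i : ℤ)) := by
    intro t
    -- Proper subsets are handled by Cohen–Macaulayness in all degrees; only the full set uses the
    -- bound on ν.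
    rcases (Finset.card_le_univ t).lt_or_eq with h | h
    · rw [Fintype.card_fin] at h
      exact gradedVanish_of_isCohenMacaulayRing hJ hCM hdim h _
    · have ht : t = Finset.univ := Finset.card_eq_iff_eq_univ t |>.1 h
      rw [ht, Finset.card_univ, Fintype.card_fin]
      exact_mod_cast htop
  rw [Submodule.eq_bot_iff]
  rintro _ ⟨htors, b, hb, rfl⟩
  obtain ⟨k, hk⟩ := exists_pow_smul_mem_span htors
  exact Ideal.Quotient.eq_zero_iff_mem.2
    (mem_span_of_pow_smul_mem_span hJ hf hg hacyclic hv hb hk)
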